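/- Let $K$ be a totally real number field of degree $n>1$, with ring of integers $\mathcal O_K$ and real embeddings $\sigma_1,\dots,\sigma_n$; write $a_i=\sigma_i(a)$ for $a\in K$. Let $\mathcal H$ be the upper half-plane, and let $\Gamma_K=\mathrm{SL}_2(\mathcal O_K)$ act on $\mathcal H^n$ by $$\gamma(z)=\Big(\frac{a_1z_1+b_1}{c_1z_1+d_1},\dots,\frac{a_nz_n+b_n}{c_nz_n+d_n}\Big),\qquad \gamma=\begin{pmatrix}a&b\\c&d\end{pmatrix}.$$ A holomorphic function $F:\mathcal H^n\to\mathbb C$ is a Hilbert quasi-modular form of weight $(k_1,\dots,k_n)\in\mathbb Z^n$ and depth $s\in\mathbb N$ if there is a polynomial $P=P(z;X_1,\dots,X_n)$ in $X_1,\dots,X_n$ of total degree $s$, with coefficients holomorphic functions of $z\in\mathcal H^n$ (the zero polynomial being given degree $0$), such that for all $z\in\mathcal H^n$ and $\gamma\in\Gamma_K$ $$F(\gamma(z))=\prod_{i=1}^n(c_iz_i+d_i)^{k_i}\;P\Big(z;\frac{c_1}{c_1z_1+d_1},\dots,\frac{c_n}{c_nz_n+d_n}\Big).$$ Let $\mathcal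 Y(K)$ be the $\mathbb C$-algebra of functions on $\mathcal H^n$ generated by the Hilbert quasi-modular forms of all weights and depths, and let $D_i=(2\pi\mathrm i)^{-1}\,\partial/\partial z_i$ for $i=1,\dots,n$. Then $D_i(\mathcal Y(K))\subseteq\mathcal Y(K)$ for every $i$, and the only nonzero principal ideal $I$ of $\mathcal Y(K)$ that satisfies $D_i(I)\subseteq I$ for all $i=1,\dots,n$ is $I=\mathcal Y(K)$ itself. -/

import Mathlib

open scoped NumberField UpperHalfPlane Real

noncomputable section

namespace HilbertQuasiModular

/-- The points of `ℋⁿ`: one coordinate in the upper half-plane for every embedding `K → ℝ`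
(there are `n = [K : ℚ]` of them when `K` is totally real). -/
abbrev HPow (K : Type*) [Field K] := (K →+* ℝ) → ℍ

/-- A function on `ℋⁿ` is holomorphic if it is complex differentiable in the coordinates
`z ∈ ℂⁿ` on the open set where all `z_σ` have positive imaginary part.
(On that set `UpperHalfPlane.ofComplex` is the inverse of the inclusion `ℍ → ℂ`.) -/
def IsHolomorphic (K : Type*) [Field K] [NumberField K] (F : HPow K → ℂ) : Prop :=
  DifferentiableOn ℂ
    (fun w : (K →+* ℝ) → ℂ => F (fun σ => UpperHalfPlane.ofComplex (w σ)))
    {w | ∀ σ, 0 < (w σ).im}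

/-- The ring `Hol(ℋⁿ)` of holomorphic functions, as a `ℂ`-algebra of functions. -/
def Hol (K : Type*) [Field K] [NumberField K] : Subalgebra ℂ (HPow K → ℂ) where
  carrier := {F | IsHolomorphic K F}
  mul_mem' hF hG := DifferentiableOn.mul hF hG
  add_mem' hF hG := DifferentiableOn.add hF hG
  algebraMap_mem' r := differentiableOn_const r

/-- Evaluation of holomorphic functions at a point of `ℋⁿ`. -/
def evalAt (K : Type*) [Field K] [NumberField K] (z : HPow K) : Hol K →+* ℂ :=
  (Pi.evalRingHom (fun _ : HPow K => ℂ) z).comp (Hol K).val.toRingHom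

/-- The image `a_σ = σ(a)` of an algebraic integer under the embedding `σ`. -/
def emb {K : Type*} [Field K] (σ : K →+* ℝ) : 𝓞 K →+* ℝ :=
  σ.comp (algebraMap (𝓞 K) K)

/-- The action of the Hilbert modular group `Γ_K = SL₂(𝒪_K)` on `ℋⁿ` by homographies:
the coordinate of index `σ` of `γ(z)` is `(a_σ z_σ + b_σ) / (c_σ z_σ + d_σ)`. -/
def act {K : Type*} [Field K] (γ : Matrix.SpecialLinearGroup (Fin 2) (𝓞 K)) (z : HPow K) :
    HPow K :=
  fun σ => Matrix.SpecialLinearGroup.map (emb σ) γ • z σ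

/-- The complex number `c_σ`, for `γ = (a b; c d)`. -/
def lowerLeft {K : Type*} [Field K] (γ : Matrix.SpecialLinearGroup (Fin 2) (𝓞 K))
    (σ : K →+* ℝ) : ℂ :=
  (emb σ (γ 1 0) : ℝ)

/-- The complex number `c_σ z_σ + d_σ`, for `γ = (a b; c d)`. -/
def factor {K : Type*} [Field K] (γ : Matrix.SpecialLinearGroup (Fin 2) (𝓞 K)) (z : HPow K)
    (σ : K →+* ℝ) : ℂ :=
  lowerLeft γ σ * (z σ : ℂ) + (emb σ (γ 1 1) : ℝ)

/-- Hilbert quasi-modular forms of weight `k ∈ ℤⁿ` and depth `s ∈ ℕ`, for a totally real field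
`K` of degree `n > 1` (for `n = 1` the classical notion has in addition a condition at the cusp):
holomorphic functions `F` on `ℋⁿ` for which there is a polynomial `P` of total degree `s` over
`Hol(ℋⁿ)`, in variables `X_σ`, such that for all `z` and all `γ`
`F(γ(z)) = ∏_σ (c_σ z_σ + d_σ)^{k_σ} · P(z)(c_σ / (c_σ z_σ + d_σ))_σ`. -/
def IsQuasiModular (K : Type*) [Field K] [NumberField K] (k : (K →+* ℝ) → ℤ) (s : ℕ)
    (F : HPow K → ℂ) : Prop :=
  IsHolomorphic K F ∧
    ∃ P : MvPolynomial (K →+* ℝ) (Hol K), P.totalDegree = s ∧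
      ∀ (z : HPow K) (γ : Matrix.SpecialLinearGroup (Fin 2) (𝓞 K)),
        F (act γ z) =
          (∏ σ, factor γ z σ ^ k σ) *
            MvPolynomial.eval₂ (evalAt K z) (fun σ => lowerLeft γ σ / factor γ z σ) P

/-- The ring `𝒴(K)` of polynomials, with complex coefficients, in the Hilbert quasi-modular
forms of all weights and depths. -/
def QuasiModularRing (K : Type*) [Field K] [NumberField K] : Subalgebra ℂ (HPow K → ℂ) :=
  Algebra.adjoin ℂ {F | ∃ (k : (K →+* ℝ) → ℤ) (s : ℕ), IsQuasiModular K k s F}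

open Classical in
/-- The derivation `D_σ = (2πi)⁻¹ ∂/∂z_σ`. -/
def D {K : Type*} [Field K] (σ : K →+* ℝ) (F : HPow K → ℂ) : HPow K → ℂ :=
  fun z => (2 * π * Complex.I)⁻¹ *
    deriv (fun w : ℂ => F (Function.update z σ (UpperHalfPlane.ofComplex w))) (z σ : ℂ)

/-- An ideal `I` of `𝒴(K)` is `𝒟`-stable if `D_σ F ∈ I` for every `F ∈ I` and every `σ`. -/
def IsDStable {K : Type*} [Field K] [NumberField K] (I : Ideal (QuasiModularRing K)) : Prop :=
  ∀ (σ : K →+* ℝ), ∀ F ∈ I, ∃ G ∈ I, (G : HPow K → ℂ) = D σ (F : HPow K → ℂ)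

end HilbertQuasiModular

end

/-!
The ring `𝒴(K)` is stable under `D_σ` because differentiating the transformation formula of a
quasi-modular form `F` gives one for `D_σ F`, with `∂P/∂z_σ`, `k_σ X_σ P` and `X_σ² ∂P/∂X_σ` in the
new polynomial (`IsQuasiModular.D`). That partial derivatives of functions holomorphic in several
variables are holomorphic is derived from Cauchy's formula in one variable
(`differentiableOn_fderiv_apply`).

For the second assertion, let `F ≠ 0` generate a stable ideal, so that `D_σ F = G_σ F` with
`G_σ ∈ 𝒴(K)` for all `σ`. It is enough to show that `F` is a modular form without zeros, since
`1/F` is then a modular form of the opposite weight and `F` is a unit. That `F` has no zeros is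
uniqueness for linear differential equations (`eq_zero_of_dHol_eq_mul`).

Write `V_σ = c_σ z_σ + d_σ`. For every element `F` of `𝒴(K)`, the product of `F(γ(z))` and a power of
`∏_σ V_σ` is the value at the bottom row `(c, d)` of `γ` of a polynomial `p` in `2n` variables with
holomorphic coefficients (`exists_rowPoly`). Such a polynomial is determined by its values, because
the bottom rows of the elements of `SL₂(𝒪_K)` are Zariski dense in `ℂ²ⁿ`: this already holds for the
rows `(a, ab + 1)` of the products of a lower and an upper unipotent matrix
(`eq_zero_of_eval_unipotent_rows`), as `𝒪_K` is Zariski dense in `ℂⁿ` by the linear independence of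
the embeddings. So `D_σ F = G_σ F` becomes an identity of polynomials: `p` divides the product of
`∂p/∂z_σ` and a product of factors `V_τ`. These are primes of the polynomial ring; split them off
and write `p = ∏ V_τ ^ k_τ · r` with no `V_τ` dividing `r`. Then `r` divides `∂r/∂z_σ`, and for
reasons of degree the quotient is a function `g_σ` of `z` alone
(`exists_coeffDerivation_eq_C_mul`). All coefficients of `r` solve the same system
`D_σ f = g_σ f`, hence are proportional, and `r = f(z) ρ(c, d)` with `ρ` a polynomial over `ℂ`
(`exists_eq_C_mul_map`).

Consequently `F(γ(z)) = ∏ V_σ ^ l_σ · F(z) · ρ(c, d)` with `l_σ ∈ ℤ`, after a normalization of `ρ`,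
and `γ ↦ ρ(c, d)` is a character of `SL₂(𝒪_K)`. It is both exponential and polynomial on lower unipotent matrices and
depends only on the bottom row, hence is trivial on all unipotent matrices, and by density `ρ = 1`
(`eval_row_eq_one`). So `F` is modular.
-/

noncomputable section

namespace HilbertQuasiModular

open MvPolynomial

/-! ### Partial derivatives of holomorphic functions of several variables -/

/-- The directional derivatives of a function that is complex differentiable on an open set are
complex differentiable. Cauchy's formula on the discs `w + t v`, `‖t‖ ≤ r`, expresses them as
integrals that can be differentiated with respect to `w`. -/
theorem differentiableOn_fderiv_apply {E : Type*} [NormedAddCommGroup E] [NormedSpace ℂ E]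
    [FiniteDimensional ℂ E] {f : E → ℂ} {U : Set E} (hU : IsOpen U)
    (hf : DifferentiableOn ℂ f U) (v : E) :
    DifferentiableOn ℂ (fun w => fderiv ℂ f w v) U := by
  intro w₀ hw₀
  apply DifferentiableAt.differentiableWithinAt
  obtain ⟨δ, hδ, hball⟩ : ∃ δ > 0, ∀ x ∈ Metric.ball w₀ δ, x ∈ U ∧ dist (f x) (f w₀) < 1 := by
    have h1 := (hf.continuousOn.continuousAt (hU.mem_nhds hw₀))
    have h2 := (hU.eventually_mem hw₀).and (h1.eventually (Metric.ball_mem_nhds _ one_pos))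
    exact Metric.eventually_nhds_iff_ball.1 h2
  have hd : ∀ x ∈ Metric.ball w₀ δ, DifferentiableAt ℂ f x := fun x hx =>
    hf.differentiableAt (hU.mem_nhds (hball x hx).1)
  obtain ⟨r, hr, hrv⟩ : ∃ r : ℝ, 0 < r ∧ r * ‖v‖ < δ / 3 := by
    refine ⟨δ / 3 / (‖v‖ + 1), by positivity, ?_⟩
    rw [div_mul_eq_mul_div, div_lt_iff₀ (by positivity)]
    nlinarith [norm_nonneg v]
  have hin : ∀ w ∈ Metric.ball w₀ (δ / 3), ∀ t : ℂ, ‖t‖ ≤ r →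
      w + t • v ∈ Metric.ball w₀ (2 * δ / 3) := by
    intro w hw t ht
    rw [mem_ball_iff_norm] at hw ⊢
    calc ‖w + t • v - w₀‖ = ‖(w - w₀) + t • v‖ := by congr 1; abel
      _ ≤ ‖w - w₀‖ + ‖t‖ * ‖v‖ := (norm_add_le _ _).trans (by rw [norm_smul])
      _ < δ / 3 + δ / 3 := add_lt_add_of_lt_of_le hw
          ((mul_le_mul_of_nonneg_right ht (norm_nonneg v)).trans hrv.le)
      _ = 2 * δ / 3 := by ring
  have hsub : Metric.ball w₀ (2 * δ / 3) ⊆ Metric.ball w₀ δ :=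
    Metric.ball_subset_ball (by linarith)
  -- by Schwarz' lemma, as `f` takes the ball of radius `δ / 3` around `x` into one of radius `2`
  have hbd : ∀ x ∈ Metric.ball w₀ (2 * δ / 3), ‖fderiv ℂ f x‖ ≤ 2 / (δ / 3) := by
    intro x hx
    have hxs : Metric.ball x (δ / 3) ⊆ Metric.ball w₀ δ := by
      apply Metric.ball_subset_ball'
      rw [Metric.mem_ball] at hx
      linarith
    apply Complex.norm_fderiv_le_div_of_mapsTo_ball
      (fun y hy => (hd y (hxs hy)).differentiableWithinAt) _ (by positivity)
    intro y hy
    apply Metric.ball_subset_closedBall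
    have h1 := (hball y (hxs hy)).2
    have h2 := (hball x (hsub hx)).2
    rw [Metric.mem_ball]
    calc dist (f y) (f x) ≤ dist (f y) (f w₀) + dist (f x) (f w₀) := dist_triangle_right _ _ _
      _ < 2 := by linarith
  -- the weight of the circle integral in the Cauchy formula for the derivative at the centre
  let k : ℝ → ℂ := fun θ => (2 * π * Complex.I : ℂ)⁻¹ *
    (deriv (circleMap 0 r) θ * ((circleMap 0 r θ - 0) ^ 2)⁻¹)
  have hk : Continuous k := by
    have h0 : ∀ θ : ℝ, (circleMap 0 r θ - 0) ^ 2 ≠ 0 := fun θ => by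
      simpa using hr.ne'
    simp only [k, deriv_circleMap]
    fun_prop (disch := exact h0 _)
  have hnorm : ∀ θ, ‖circleMap 0 r θ‖ ≤ r := fun θ => by simp [abs_of_pos hr]
  have hcauchy : ∀ w ∈ Metric.ball w₀ (δ / 3), fderiv ℂ f w v =
      ∫ θ in Set.Ioc 0 (2 * π), k θ * f (w + circleMap 0 r θ • v) := by
    intro w hw
    have hl : ∀ t : ℂ, HasDerivAt (fun t : ℂ => w + t • v) v t := fun t => by
      simpa using ((hasDerivAt_id t).smul_const v).const_add w
    have hV : IsOpen {t : ℂ | w + t • v ∈ Metric.ball w₀ δ} :=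
      Metric.isOpen_ball.preimage (by fun_prop)
    have hdiff : DifferentiableOn ℂ (fun t : ℂ => f (w + t • v))
        {t : ℂ | w + t • v ∈ Metric.ball w₀ δ} := fun t ht =>
      ((hd _ ht).comp t (hl t).differentiableAt).differentiableWithinAt
    have h := Complex.two_pi_I_inv_smul_circleIntegral_sub_sq_inv_smul_of_differentiable hV
      (c := 0) (R := r) (w₀ := 0)
      (fun t ht => hsub (hin w hw t (by simpa using ht))) hdiff (Metric.mem_ball_self hr)
    have h0 : HasDerivAt (fun t : ℂ => f (w + t • v)) (fderiv ℂ f w v) 0 := by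
      have hfw : HasFDerivAt f (fderiv ℂ f w) (w + (0 : ℂ) • v) := by
        rw [zero_smul, add_zero]
        exact (hd w (Metric.ball_subset_ball (by linarith) hw)).hasFDerivAt
      exact hfw.comp_hasDerivAt 0 (hl 0)
    rw [h0.deriv] at h
    rw [← h, circleIntegral, intervalIntegral.integral_of_le (by positivity),
      smul_eq_mul, ← MeasureTheory.integral_const_mul]
    simp only [k, smul_eq_mul]
    congr 1
    ext θ
    ring
  have hcont : ∀ w ∈ Metric.ball w₀ (δ / 3),
      Continuous (fun θ => k θ * f (w + circleMap 0 r θ • v)) := by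
    intro w hw
    refine hk.mul (continuous_iff_continuousAt.2 fun θ => ?_)
    exact ContinuousAt.comp (f := fun θ => w + circleMap 0 r θ • v)
      (hd _ (hsub (hin w hw _ (hnorm θ)))).continuousAt (by fun_prop)
  obtain ⟨C, hC⟩ : ∃ C, ∀ θ ∈ Set.Icc 0 (2 * π), ‖k θ‖ ≤ C :=
    isCompact_Icc.exists_bound_of_continuousOn hk.continuousOn
  have hnhds : Metric.ball w₀ (δ / 3) ∈ nhds w₀ := Metric.ball_mem_nhds _ (by positivity)
  have hI := hasFDerivAt_integral_of_dominated_of_fderiv_le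
    (μ := MeasureTheory.volume.restrict (Set.Ioc 0 (2 * π))) (𝕜 := ℂ)
    (F := fun w θ => k θ * f (w + circleMap 0 r θ • v))
    (F' := fun w θ => k θ • fderiv ℂ f (w + circleMap 0 r θ • v))
    (bound := fun _ => C * (2 / (δ / 3))) (x₀ := w₀) hnhds
    (Filter.eventually_of_mem hnhds fun w hw => (hcont w hw).aestronglyMeasurable)
    ((hcont w₀ (Metric.mem_ball_self (by positivity))).integrableOn_Ioc)
    (by
      borelize E (E →L[ℂ] ℂ)
      have : ProperSpace E := FiniteDimensional.proper ℂ E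
      have hm : Measurable (fun θ => fderiv ℂ f (w₀ + circleMap 0 r θ • v)) :=
        (measurable_fderiv ℂ f).comp (Continuous.measurable (by fun_prop))
      exact (hk.measurable.smul hm).aestronglyMeasurable)
    (by
      filter_upwards [MeasureTheory.ae_restrict_mem measurableSet_Ioc] with θ hθ w hw
      rw [norm_smul]
      exact mul_le_mul (hC θ (Set.Ioc_subset_Icc_self hθ)) (hbd _ (hin w hw _ (hnorm θ)))
        (norm_nonneg _) ((norm_nonneg _).trans (hC θ (Set.Ioc_subset_Icc_self hθ))))
    (MeasureTheory.integrable_const _)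
    (by
      refine Filter.Eventually.of_forall fun θ w hw => ?_
      have h1 := (hd _ (hsub (hin w hw _ (hnorm θ)))).hasFDerivAt
      have h2 : HasFDerivAt (fun w => w + circleMap 0 r θ • v) (ContinuousLinearMap.id ℂ E) w :=
        (hasFDerivAt_id w).add_const _
      simpa using (h1.comp w h2).const_mul (k θ))
  exact (hI.congr_of_eventuallyEq
    (Filter.eventually_of_mem hnhds fun w hw => hcauchy w hw)).differentiableAt

/-! ### The ring of holomorphic functions on `ℋⁿ` -/

section HolomorphicFunctions

variable {K : Type*} [Field K]

/-- The function of `w ∈ ℂⁿ` that a function on `ℋⁿ` defines, meaningful where all `w_σ` have positive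
imaginary part. -/
def extend (F : HPow K → ℂ) (w : (K →+* ℝ) → ℂ) : ℂ :=
  F fun σ => UpperHalfPlane.ofComplex (w σ)

/-- The inclusion of `ℋⁿ` in `ℂⁿ`. -/
abbrev toVec (z : HPow K) : (K →+* ℝ) → ℂ := fun σ => (z σ : ℂ)

variable (K) in
/-- The image of `ℋⁿ` in `ℂⁿ`. -/
abbrev halfSpace : Set ((K →+* ℝ) → ℂ) := {w | ∀ σ, 0 < (w σ).im}

theorem isOpen_halfSpace [NumberField K] : IsOpen (halfSpace K) := by
  simp only [halfSpace, Set.ofPred_forall]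
  exact isOpen_iInter_of_finite fun σ => isOpen_lt continuous_const (by fun_prop)

theorem convex_halfSpace : Convex ℝ (halfSpace K) := by
  intro w hw v hv a b ha hb hab σ
  have h1 := hw σ
  have h2 := hv σ
  have : (a • w + b • v) σ = (a : ℂ) * w σ + (b : ℂ) * v σ := by simp
  rw [this]
  simp only [Complex.add_im, Complex.im_ofReal_mul]
  rcases ha.eq_or_lt with rfl | ha
  · obtain rfl : b = 1 := by linarith
    simpa using h2
  · have := mul_pos ha h1
    have := mul_nonneg hb h2.le
    linarith

theorem toVec_mem_halfSpace (z : HPow K) : toVec z ∈ halfSpace K := fun σ => (z σ).im_pos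

@[simp]
theorem extend_toVec (F : HPow K → ℂ) (z : HPow K) : extend F (toVec z) = F z := by
  simp [extend, UpperHalfPlane.ofComplex_apply]

theorem toVec_ofComplex {w : (K →+* ℝ) → ℂ} (hw : w ∈ halfSpace K) :
    toVec (fun σ => UpperHalfPlane.ofComplex (w σ)) = w := by
  ext σ
  simp [toVec, UpperHalfPlane.ofComplex_apply_of_im_pos (hw σ)]

theorem IsHolomorphic.differentiableAt [NumberField K] {F : HPow K → ℂ} (hF : IsHolomorphic K F)
    {w : (K →+* ℝ) → ℂ} (hw : w ∈ halfSpace K) : DifferentiableAt ℂ (extend F) w :=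
  DifferentiableOn.differentiableAt hF (isOpen_halfSpace.mem_nhds hw)

open Classical in
/-- The point `(z₁, …, w, …, zₙ)`, with the coordinate of index `σ` replaced by `w ∈ ℂ`. The
operator `D σ` differentiates `F` along this slice. Where `w` does not lie in the upper half-plane,
the value of `ofComplex` is a junk value, but a derivative at `w = z_σ` does not depend on it. -/
def slice (σ : K →+* ℝ) (z : HPow K) (w : ℂ) : HPow K :=
  Function.update z σ (UpperHalfPlane.ofComplex w)

@[simp]
theorem slice_self (σ : K →+* ℝ) (z : HPow K) : slice σ z (z σ) = z := by
  simp [slice, UpperHalfPlane.ofComplex_apply]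

open Classical in
theorem slice_apply (σ τ : K →+* ℝ) (z : HPow K) (w : ℂ) :
    slice σ z w τ = if τ = σ then UpperHalfPlane.ofComplex w else z τ := by
  simp [slice, Function.update_apply]

theorem D_apply (σ : K →+* ℝ) (F : HPow K → ℂ) (z : HPow K) :
    D σ F z = (2 * π * Complex.I)⁻¹ * deriv (fun w => F (slice σ z w)) (z σ) := rfl

theorem exists_toVec_eq {w : (K →+* ℝ) → ℂ} (hw : w ∈ halfSpace K) : ∃ z, toVec z = w :=
  ⟨_, toVec_ofComplex hw⟩

theorem D_eq_of_hasDerivAt {F : HPow K → ℂ} {σ : K →+* ℝ} {z : HPow K} {a : ℂ}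
    (h : HasDerivAt (fun w => F (slice σ z w)) (2 * π * Complex.I * a) (z σ)) : D σ F z = a := by
  rw [D_apply, h.deriv, inv_mul_cancel_left₀ Complex.two_pi_I_ne_zero]

variable [NumberField K]

open Classical in
theorem IsHolomorphic.hasDerivAt_slice_fderiv {F : HPow K → ℂ} (hF : IsHolomorphic K F)
    (σ : K →+* ℝ) (z : HPow K) :
    HasDerivAt (fun w => F (slice σ z w))
      (fderiv ℂ (extend F) (toVec z) (Pi.single σ 1)) (z σ) := by
  have h1 : (fun w => F (slice σ z w)) =
      fun w => extend F (Function.update (toVec z) σ w) := by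
    ext w
    congr 1
    ext τ
    rw [slice_apply, Function.update_apply]
    split_ifs <;> simp [UpperHalfPlane.ofComplex_apply]
  rw [h1]
  have h2 : Function.update (toVec z) σ (z σ : ℂ) = toVec z := Function.update_eq_self σ _
  refine HasFDerivAt.comp_hasDerivAt (l := extend F) (z σ : ℂ) ?_
    (hasDerivAt_update (toVec z) σ (z σ : ℂ))
  rw [h2]
  exact (hF.differentiableAt (toVec_mem_halfSpace z)).hasFDerivAt

theorem IsHolomorphic.hasDerivAt_slice {F : HPow K → ℂ} (hF : IsHolomorphic K F)
    (σ : K →+* ℝ) (z : HPow K) :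
    HasDerivAt (fun w => F (slice σ z w)) (2 * π * Complex.I * D σ F z) (z σ) := by
  have h := hF.hasDerivAt_slice_fderiv σ z
  rw [D_apply, h.deriv, mul_inv_cancel_left₀ Complex.two_pi_I_ne_zero]
  exact h

open Classical in
theorem IsHolomorphic.fderiv_single {F : HPow K → ℂ} (hF : IsHolomorphic K F)
    (σ : K →+* ℝ) (z : HPow K) :
    fderiv ℂ (extend F) (toVec z) (Pi.single σ 1) = 2 * π * Complex.I * D σ F z :=
  (hF.hasDerivAt_slice_fderiv σ z).unique (hF.hasDerivAt_slice σ z)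

theorem IsHolomorphic.D {F : HPow K → ℂ} (hF : IsHolomorphic K F) (σ : K →+* ℝ) :
    IsHolomorphic K (D σ F) := by
  classical
  have h := (differentiableOn_fderiv_apply isOpen_halfSpace hF (Pi.single σ 1)).const_mul
    (2 * π * Complex.I : ℂ)⁻¹
  refine DifferentiableOn.congr h fun w hw => ?_
  have h1 := hF.fderiv_single σ (fun σ => UpperHalfPlane.ofComplex (w σ))
  rw [toVec_ofComplex hw] at h1
  erw [h1]
  rw [inv_mul_cancel_left₀ Complex.two_pi_I_ne_zero]

/-- The derivation `D_σ` of the ring of holomorphic functions. -/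
def dHol (σ : K →+* ℝ) : Derivation ℂ (Hol K) (Hol K) where
  toFun F := ⟨D σ F, IsHolomorphic.D F.2 σ⟩
  map_add' F G := by
    ext z
    apply D_eq_of_hasDerivAt
    convert! (IsHolomorphic.hasDerivAt_slice F.2 σ z).add
      (IsHolomorphic.hasDerivAt_slice G.2 σ z) using 1
    simp [mul_add]
  map_smul' c F := by
    ext z
    apply D_eq_of_hasDerivAt
    convert! (IsHolomorphic.hasDerivAt_slice F.2 σ z).const_mul c using 1
    simp
    ring
  map_one_eq_zero' := by
    ext z
    apply D_eq_of_hasDerivAt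
    simpa using hasDerivAt_const (z σ : ℂ) (1 : ℂ)
  leibniz' F G := by
    ext z
    apply D_eq_of_hasDerivAt
    convert! (IsHolomorphic.hasDerivAt_slice F.2 σ z).mul
      (IsHolomorphic.hasDerivAt_slice G.2 σ z) using 1
    simp
    ring

@[simp]
theorem coe_dHol (σ : K →+* ℝ) (F : Hol K) : (dHol σ F : HPow K → ℂ) = D σ (F : HPow K → ℂ) := rfl

theorem evalAt_apply (z : HPow K) (F : Hol K) : evalAt K z F = (F : HPow K → ℂ) z := rfl

theorem Hol.ext_evalAt {F G : Hol K} (h : ∀ z, evalAt K z F = evalAt K z G) : F = G :=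
  Subtype.ext (funext h)

theorem hasDerivAt_evalAt (σ : K →+* ℝ) (z : HPow K) (F : Hol K) :
    HasDerivAt (fun w => evalAt K (slice σ z w) F)
      (2 * π * Complex.I * evalAt K z (dHol σ F)) (z σ) :=
  IsHolomorphic.hasDerivAt_slice F.2 σ z

theorem evalAt_algebraMap (z : HPow K) (c : ℂ) : evalAt K z (algebraMap ℂ (Hol K) c) = c := rfl

/-- The derivative of a holomorphic function along the complex line through `z₀` and `z₁`, at a
parameter `t` whose point `z` lies in `ℋⁿ`. -/
theorem hasDerivAt_line (F : Hol K) (z₀ z₁ : HPow K) {t : ℂ} {z : HPow K}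
    (hz : toVec z = toVec z₀ + t • (toVec z₁ - toVec z₀)) :
    HasDerivAt (fun t : ℂ => extend F (toVec z₀ + t • (toVec z₁ - toVec z₀)))
      (∑ σ, (toVec z₁ - toVec z₀) σ * (2 * π * Complex.I * evalAt K z (dHol σ F))) t := by
  classical
  have hF : IsHolomorphic K F := F.2
  have h1 : HasDerivAt (fun t : ℂ => toVec z₀ + t • (toVec z₁ - toVec z₀))
      (toVec z₁ - toVec z₀) t := by
    simpa using ((hasDerivAt_id t).smul_const (toVec z₁ - toVec z₀)).const_add (toVec z₀)
  have h2 := (hF.differentiableAt (toVec_mem_halfSpace z)).hasFDerivAt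
  rw [hz] at h2
  convert! h2.comp_hasDerivAt t h1 using 1
  rw [← hz]
  conv_rhs => rw [← Finset.univ_sum_single (toVec z₁ - toVec z₀), map_sum]
  refine Finset.sum_congr rfl fun σ _ => ?_
  have : (Pi.single σ ((toVec z₁ - toVec z₀) σ) : (K →+* ℝ) → ℂ) =
      (toVec z₁ - toVec z₀) σ • Pi.single σ 1 := by
    rw [← Pi.single_smul, smul_eq_mul, mul_one]
  rw [this, map_smul, hF.fderiv_single, smul_eq_mul]
  rfl

/-- The ring `Hol(ℋⁿ)` is a domain: on the complex line through a point where `F` does not vanish and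
a point where `G` does not vanish, this is the identity theorem in one variable. -/
instance : IsDomain (Hol K) := by
  have : Nontrivial (Hol K) :=
    ⟨0, 1, fun h => zero_ne_one (congrArg (evalAt K fun _ => UpperHalfPlane.I) h)⟩
  have : NoZeroDivisors (Hol K) := by
    refine ⟨fun {F G} hFG => ?_⟩
    by_contra! h
    obtain ⟨z₀, hz₀⟩ : ∃ z, evalAt K z F ≠ 0 := by
      by_contra! h'; exact h.1 (Hol.ext_evalAt (by simpa using h'))
    obtain ⟨z₁, hz₁⟩ : ∃ z, evalAt K z G ≠ 0 := by
      by_contra! h'; exact h.2 (Hol.ext_evalAt (by simpa using h'))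
    let l : ℂ → (K →+* ℝ) → ℂ := fun t => toVec z₀ + t • (toVec z₁ - toVec z₀)
    have hl : Continuous l := by fun_prop
    have hV : IsOpen (l ⁻¹' halfSpace K) := isOpen_halfSpace.preimage hl
    have hc : Convex ℝ (l ⁻¹' halfSpace K) := by
      intro s hs t ht a b ha hb hab
      have : l (a • s + b • t) = a • l s + b • l t := by
        have hab' : (a : ℂ) + b = 1 := by exact_mod_cast hab
        ext σ
        simp only [l, Pi.add_apply, Pi.smul_apply, Complex.real_smul, smul_eq_mul]
        linear_combination (- toVec z₀ σ) * hab'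
      rw [Set.mem_preimage, this]
      exact convex_halfSpace hs ht ha hb hab
    have han : ∀ F : Hol K, AnalyticOnNhd ℂ (fun t => extend F (l t)) (l ⁻¹' halfSpace K) := by
      intro F
      refine DifferentiableOn.analyticOnNhd (fun t ht => ?_) hV
      obtain ⟨z, hz⟩ := exists_toVec_eq ht
      exact (hasDerivAt_line F z₀ z₁ hz).differentiableAt.differentiableWithinAt
    have h0 : l 0 = toVec z₀ := by simp [l]
    have h1 : l 1 = toVec z₁ := by simp [l]
    rcases AnalyticOnNhd.eq_zero_or_eq_zero_of_mul_eq_zero (han F) (han G)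
      (fun t ht => congrFun (congrArg Subtype.val hFG) _) hc.isPreconnected with h | h
    · have := h 0 (by rw [Set.mem_preimage, h0]; exact toVec_mem_halfSpace z₀)
      rw [h0, extend_toVec] at this
      exact hz₀ this
    · have := h 1 (by rw [Set.mem_preimage, h1]; exact toVec_mem_halfSpace z₁)
      rw [h1, extend_toVec] at this
      exact hz₁ this
  exact NoZeroDivisors.to_isDomain _

/-- A solution of the system `D_σ F = g_σ F` that vanishes at a point is zero: along the segment
from that point to any other, it solves a linear differential equation. -/
theorem eq_zero_of_dHol_eq_mul {F : Hol K} {g : (K →+* ℝ) → Hol K}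
    (hF : ∀ σ, dHol σ F = g σ * F) {z₀ : HPow K} (h₀ : evalAt K z₀ F = 0) : F = 0 := by
  apply Hol.ext_evalAt
  intro z₁
  rw [map_zero]
  let l : ℝ → (K →+* ℝ) → ℂ := fun t => toVec z₀ + (t : ℂ) • (toVec z₁ - toVec z₀)
  have hl : Continuous l := by fun_prop
  have hmem : ∀ t ∈ Set.Icc (0 : ℝ) 1, l t ∈ halfSpace K := by
    intro t ht
    have := convex_halfSpace (toVec_mem_halfSpace z₀) (toVec_mem_halfSpace z₁)
      (sub_nonneg.2 ht.2) ht.1 (by ring)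
    convert! this using 1
    ext σ
    simp only [l, Pi.add_apply, Pi.smul_apply, Pi.sub_apply, Complex.real_smul, smul_eq_mul]
    push_cast
    ring
  -- along the segment `l`, the equation for `F` reads `F' = a F`
  let a : ℝ → ℂ := fun t =>
    ∑ σ, (toVec z₁ - toVec z₀) σ * (2 * π * Complex.I * extend (g σ) (l t))
  have hext : ∀ F : Hol K, ContinuousOn (fun t => extend F (l t)) (Set.Icc 0 1) := fun F =>
    ContinuousOn.comp (g := extend (F : HPow K → ℂ)) (t := halfSpace K) (DifferentiableOn.continuousOn F.2) hl.continuousOn hmem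
  have hcont : ContinuousOn a (Set.Icc 0 1) :=
    continuousOn_finsetSum _ fun σ _ =>
      continuousOn_const.mul (continuousOn_const.mul (hext (g σ)))
  obtain ⟨C, hC⟩ := isCompact_Icc.exists_bound_of_continuousOn hcont
  have hderiv : ∀ t ∈ Set.Icc (0 : ℝ) 1,
      HasDerivAt (fun t => extend F (l t)) (a t * extend F (l t)) t := by
    intro t ht
    obtain ⟨z, hz⟩ := exists_toVec_eq (hmem t ht)
    have h := (hasDerivAt_line F z₀ z₁ hz).comp_ofReal
    convert! h using 1
    simp only [a, Finset.sum_mul, ← hz, extend_toVec]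
    refine Finset.sum_congr rfl fun σ _ => ?_
    rw [hF, map_mul]
    simp only [evalAt_apply]
    ring
  have key := ODE_solution_unique_of_mem_Icc_right (v := fun t x => a t * x)
    (s := fun _ => Set.univ) (K := C.toNNReal) (f := fun t => extend F (l t)) (g := fun _ => 0)
    (a := 0) (b := 1)
    (fun t ht => by
      apply LipschitzWith.lipschitzOnWith
      apply LipschitzWith.of_dist_le_mul
      intro x y
      rw [dist_eq_norm, dist_eq_norm, ← mul_sub, norm_mul]
      exact mul_le_mul_of_nonneg_right
        ((hC t (Set.Ico_subset_Icc_self ht)).trans (Real.le_coe_toNNReal C)) (norm_nonneg _))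
    (hext F) (fun t ht => (hderiv t (Set.Ico_subset_Icc_self ht)).hasDerivWithinAt)
    (fun _ _ => trivial) continuousOn_const
    (fun t ht => by simpa using hasDerivWithinAt_const t _ (0 : ℂ)) (fun _ _ => trivial)
    (by
      have : l 0 = toVec z₀ := by simp [l]
      simpa [this, evalAt_apply] using h₀)
  have h1 := key (Set.right_mem_Icc.2 zero_le_one)
  have : l 1 = toVec z₁ := by simp [l]
  simpa [this, evalAt_apply] using h1

end HolomorphicFunctions

/-! ### Derivations of polynomial rings acting on the coefficients -/

section CoeffDerivation

variable {R A : Type*} [CommRing R] [CommRing A] [Algebra R A] (κ : Type*)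

theorem coeff_sum_monomial_apply (d : Derivation R A A) (p : MvPolynomial κ A) (m : κ →₀ ℕ) :
    coeff m (∑ n ∈ p.support, monomial n (d (coeff n p))) = d (coeff m p) := by
  classical
  rw [coeff_sum]
  simp only [coeff_monomial, Finset.sum_ite_eq', mem_support_iff]
  split_ifs with h
  · rfl
  · rw [not_not.1 h, map_zero]

/-- The extension of a derivation of `A` to the polynomials over `A` that sends the variables
to `0`: it is applied to the coefficients. -/
def coeffDerivation (d : Derivation R A A) :
    Derivation R (MvPolynomial κ A) (MvPolynomial κ A) where
  toFun p := ∑ m ∈ p.support, monomial m (d (coeff m p))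
  map_add' p q := by
    ext m
    rw [coeff_sum_monomial_apply]
    rw [coeff_add, coeff_add, coeff_sum_monomial_apply, coeff_sum_monomial_apply, map_add]
  map_smul' c p := by
    ext m
    rw [RingHom.id_apply, coeff_smul, coeff_sum_monomial_apply, coeff_sum_monomial_apply,
      coeff_smul, d.map_smul]
  map_one_eq_zero' := by
    classical
    ext m
    simp only [LinearMap.coe_mk, AddHom.coe_mk]
    rw [coeff_sum_monomial_apply, coeff_one, coeff_zero]
    split_ifs <;> simp
  leibniz' p q := by
    classical
    ext m
    simp only [LinearMap.coe_mk, AddHom.coe_mk]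
    rw [coeff_sum_monomial_apply, coeff_mul, map_sum, coeff_add, smul_eq_mul, smul_eq_mul,
      coeff_mul, coeff_mul]
    simp only [coeff_sum_monomial_apply, smul_eq_mul, Derivation.leibniz, Finset.sum_add_distrib]
    congr 1
    exact Finset.sum_equiv (Equiv.prodComm _ _) (fun x => by simp [add_comm]) (fun x _ => rfl)

variable {κ}

@[simp]
theorem coeff_coeffDerivation (d : Derivation R A A) (p : MvPolynomial κ A) (m : κ →₀ ℕ) :
    coeff m (coeffDerivation κ d p) = d (coeff m p) :=
  coeff_sum_monomial_apply κ d p m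

@[simp]
theorem coeffDerivation_C (d : Derivation R A A) (a : A) :
    coeffDerivation κ d (C a) = C (d a) := by
  classical
  ext m
  rw [coeff_coeffDerivation, coeff_C, coeff_C]
  split_ifs <;> simp

@[simp]
theorem coeffDerivation_X (d : Derivation R A A) (i : κ) : coeffDerivation κ d (X i) = 0 := by
  classical
  ext m
  rw [coeff_coeffDerivation, coeff_X, coeff_zero]
  split_ifs <;> simp

theorem totalDegree_coeffDerivation_le (d : Derivation R A A) (p : MvPolynomial κ A) :
    (coeffDerivation κ d p).totalDegree ≤ p.totalDegree := by
  refine Finset.sup_mono fun m hm => ?_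
  rw [mem_support_iff] at hm ⊢
  intro h
  rw [coeff_coeffDerivation, h, map_zero] at hm
  exact hm rfl

end CoeffDerivation

/-! ### Derivatives of the action and of the automorphy factor -/

section Action

variable {K : Type*} [Field K]

theorem coe_act (γ : Matrix.SpecialLinearGroup (Fin 2) (𝓞 K)) (z : HPow K) (σ : K →+* ℝ) :
    (act γ z σ : ℂ) = ((emb σ (γ 0 0) : ℝ) * (z σ : ℂ) + (emb σ (γ 0 1) : ℝ)) / factor γ z σ :=
  UpperHalfPlane.coe_specialLinearGroup_apply _ _

theorem factor_ne_zero (γ : Matrix.SpecialLinearGroup (Fin 2) (𝓞 K)) (z : HPow K)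
    (σ : K →+* ℝ) : factor γ z σ ≠ 0 :=
  UpperHalfPlane.denom_ne_zero
    (Matrix.SpecialLinearGroup.map (emb σ) γ : Matrix.SpecialLinearGroup (Fin 2) ℝ) (z σ)

theorem act_mul (γ δ : Matrix.SpecialLinearGroup (Fin 2) (𝓞 K)) (z : HPow K) :
    act (γ * δ) z = act γ (act δ z) := by
  ext1 σ
  simp only [act, map_mul, mul_smul]

@[simp]
theorem act_one (z : HPow K) : act 1 z = z := by
  ext1 σ
  simp [act]

@[simp]
theorem factor_one (z : HPow K) (σ : K →+* ℝ) : factor 1 z σ = 1 := by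
  simp [factor, lowerLeft]

theorem emb_det (γ : Matrix.SpecialLinearGroup (Fin 2) (𝓞 K)) (σ : K →+* ℝ) :
    ((emb σ (γ 0 0) : ℝ) : ℂ) * (emb σ (γ 1 1) : ℝ) -
      (emb σ (γ 0 1) : ℝ) * (emb σ (γ 1 0) : ℝ) = 1 := by
  have h := γ.det_coe
  rw [Matrix.det_fin_two] at h
  have h' := congrArg (fun x => ((emb σ x : ℝ) : ℂ)) h
  simpa using h'

/-- The cocycle relation of the automorphy factor. -/
theorem factor_mul (γ δ : Matrix.SpecialLinearGroup (Fin 2) (𝓞 K)) (z : HPow K) (σ : K →+* ℝ) :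
    factor (γ * δ) z σ = factor γ (act δ z) σ * factor δ z σ := by
  have h := factor_ne_zero δ z σ
  rw [factor.eq_1 γ (act δ z) σ, coe_act, add_mul, mul_assoc, div_mul_cancel₀ _ h]
  simp only [factor, lowerLeft, Matrix.SpecialLinearGroup.coe_mul, Matrix.mul_apply,
    Fin.sum_univ_two, map_add, map_mul, Complex.ofReal_add, Complex.ofReal_mul]
  ring

theorem slice_eventually (σ : K →+* ℝ) (z : HPow K) :
    ∀ᶠ w in nhds (z σ : ℂ), (slice σ z w σ : ℂ) = w := by
  have : ∀ᶠ w in nhds (z σ : ℂ), 0 < w.im :=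
    (isOpen_lt continuous_const Complex.continuous_im).mem_nhds (z σ).im_pos
  filter_upwards [this] with w hw
  simp [slice_apply, UpperHalfPlane.ofComplex_apply_of_im_pos hw]

theorem hasDerivAt_slice_self (σ : K →+* ℝ) (z : HPow K) :
    HasDerivAt (fun w => (slice σ z w σ : ℂ)) 1 (z σ) :=
  (hasDerivAt_id _).congr_of_eventuallyEq (slice_eventually σ z)

theorem slice_of_ne {σ τ : K →+* ℝ} (h : τ ≠ σ) (z : HPow K) (w : ℂ) : slice σ z w τ = z τ := by
  simp [slice_apply, h]

theorem factor_slice_of_ne {σ τ : K →+* ℝ} (h : τ ≠ σ)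
    (γ : Matrix.SpecialLinearGroup (Fin 2) (𝓞 K)) (z : HPow K) (w : ℂ) :
    factor γ (slice σ z w) τ = factor γ z τ := by
  simp [factor, slice_of_ne h]

theorem hasDerivAt_factor (γ : Matrix.SpecialLinearGroup (Fin 2) (𝓞 K)) (σ : K →+* ℝ)
    (z : HPow K) :
    HasDerivAt (fun w => factor γ (slice σ z w) σ) (lowerLeft γ σ) (z σ) := by
  simpa [factor] using ((hasDerivAt_slice_self σ z).const_mul (lowerLeft γ σ)).add_const
    ((emb σ (γ 1 1) : ℝ) : ℂ)

theorem act_slice (γ : Matrix.SpecialLinearGroup (Fin 2) (𝓞 K)) (σ : K →+* ℝ)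
    (z : HPow K) (w : ℂ) :
    act γ (slice σ z w) = slice σ (act γ z) (act γ (slice σ z w) σ) := by
  ext1 τ
  by_cases h : τ = σ
  · subst h
    simp [slice_apply (K := K) τ τ (act γ z), UpperHalfPlane.ofComplex_apply]
  · rw [slice_of_ne h, act, act, slice_of_ne h]

/-- The derivative of a homography of determinant `1`. -/
theorem hasDerivAt_act (γ : Matrix.SpecialLinearGroup (Fin 2) (𝓞 K)) (σ : K →+* ℝ)
    (z : HPow K) :
    HasDerivAt (fun w => (act γ (slice σ z w) σ : ℂ)) (factor γ z σ ^ 2)⁻¹ (z σ) := by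
  have hf := factor_ne_zero γ z σ
  have h := (((hasDerivAt_slice_self σ z).const_mul ((emb σ (γ 0 0) : ℝ) : ℂ)).add_const
    ((emb σ (γ 0 1) : ℝ) : ℂ)).div (hasDerivAt_factor γ σ z) (by simpa using hf)
  convert! h using 1
  · ext w
    rw [coe_act]
    rfl
  · rw [slice_self, inv_eq_one_div]
    congr 1
    simp only [factor, lowerLeft]
    linear_combination -emb_det γ σ

variable [NumberField K]

/-- The chain rule for `z ↦ F(γ(z))`. -/
theorem IsHolomorphic.hasDerivAt_act {F : HPow K → ℂ} (hF : IsHolomorphic K F)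
    (γ : Matrix.SpecialLinearGroup (Fin 2) (𝓞 K)) (σ : K →+* ℝ) (z : HPow K) :
    HasDerivAt (fun w => F (act γ (slice σ z w)))
      (2 * π * Complex.I * (HilbertQuasiModular.D σ F (act γ z) / factor γ z σ ^ 2)) (z σ) := by
  have h1 : (fun w => F (act γ (slice σ z w))) =
      (fun w => F (slice σ (act γ z) w)) ∘ fun w => (act γ (slice σ z w) σ : ℂ) := by
    ext w
    rw [Function.comp, ← act_slice]
  have h2 := hF.hasDerivAt_slice σ (act γ z)
  have h3 : act γ z σ = act γ (slice σ z (z σ)) σ := by rw [slice_self]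
  conv at h2 => arg 3; rw [h3]
  rw [h1]
  convert! h2.comp (z σ : ℂ) (HilbertQuasiModular.hasDerivAt_act γ σ z) using 1
  rw [div_eq_mul_inv, ← mul_assoc]

theorem hasDerivAt_prod_factor_zpow (γ : Matrix.SpecialLinearGroup (Fin 2) (𝓞 K))
    (k : (K →+* ℝ) → ℤ) (σ : K →+* ℝ) (z : HPow K) :
    HasDerivAt (fun w => ∏ τ, factor γ (slice σ z w) τ ^ k τ)
      ((∏ τ, factor γ z τ ^ k τ) * (k σ * (lowerLeft γ σ / factor γ z σ))) (z σ) := by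
  classical
  have hf := factor_ne_zero γ z σ
  have h1 : ∀ w, ∏ τ, factor γ (slice σ z w) τ ^ k τ =
      factor γ (slice σ z w) σ ^ k σ * ∏ τ ∈ Finset.univ.erase σ, factor γ z τ ^ k τ := by
    intro w
    rw [← Finset.mul_prod_erase _ _ (Finset.mem_univ σ)]
    congr 1
    exact Finset.prod_congr rfl fun τ hτ => by
      rw [factor_slice_of_ne (Finset.ne_of_mem_erase hτ)]
  have h2 := h1 (z σ)
  rw [slice_self] at h2
  rw [h2]
  simp only [h1]
  have h3 : HasDerivAt (fun x : ℂ => x ^ k σ)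
      (k σ * factor γ (slice σ z (z σ)) σ ^ (k σ - 1)) (factor γ (slice σ z (z σ)) σ) :=
    hasDerivAt_zpow _ _ (Or.inl (by simpa using hf))
  convert! (h3.comp (z σ : ℂ) (hasDerivAt_factor γ σ z)).mul_const _ using 1
  rw [slice_self, zpow_sub_one₀ hf]
  ring

end Action

/-! ### Derivatives of polynomials with holomorphic coefficients -/

section Evaluation

variable {K : Type*} [Field K] [NumberField K] {κ : Type*}


/-- The total derivative with respect to `z_σ` of a polynomial with holomorphic coefficients, at
arguments that depend on `z_σ`. -/
theorem hasDerivAt_eval₂ [Fintype κ] (σ : K →+* ℝ) (z : HPow K) {x : ℂ → κ → ℂ} {x' : κ → ℂ}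
    (hx : ∀ i, HasDerivAt (fun w => x w i) (x' i) (z σ)) (p : MvPolynomial κ (Hol K)) :
    HasDerivAt (fun w => eval₂ (evalAt K (slice σ z w)) (x w) p)
      (2 * π * Complex.I * eval₂ (evalAt K z) (x (z σ)) (coeffDerivation κ (dHol σ) p) +
        ∑ i, x' i * eval₂ (evalAt K z) (x (z σ)) (pderiv i p)) (z σ) := by
  classical
  induction p using MvPolynomial.induction_on with
  | C F => simpa using hasDerivAt_evalAt σ z F
  | add p q hp hq =>
    convert! hp.add hq using 1
    · ext w
      simp
    · simp only [map_add, eval₂_add, mul_add, Finset.sum_add_distrib]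
      ring
  | mul_X p j hp =>
    convert! hp.mul (hx j) using 1
    · ext w
      simp
    · simp only [Derivation.leibniz, smul_eq_mul, coeffDerivation_X, mul_zero, zero_add,
        eval₂_mul, eval₂_X, pderiv_X, eval₂_add, Pi.single_apply, mul_add,
        Finset.sum_add_distrib, slice_self]
      have h1 : ∀ i, eval₂ (evalAt K z) (x (z σ)) (if j = i then 1 else 0 : MvPolynomial κ (Hol K))
          = if j = i then 1 else 0 := fun i => by split_ifs <;> simp
      simp only [h1, mul_ite, mul_one, mul_zero, Finset.sum_ite_eq, Finset.mem_univ, if_true]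
      rw [add_mul, Finset.sum_mul, mul_comm (x' j)]
      rw [add_comm (_ * _) (∑ i, _), ← add_assoc]
      congr 2
      · ring
      · exact Finset.sum_congr rfl fun i _ => by ring

end Evaluation

/-! ### Stability of `𝒴(K)` under the derivations -/

section Derivatives

variable {K : Type*} [Field K]

theorem hasDerivAt_lowerLeft_div_factor (γ : Matrix.SpecialLinearGroup (Fin 2) (𝓞 K))
    (σ : K →+* ℝ) (z : HPow K) :
    HasDerivAt (fun w => lowerLeft γ σ / factor γ (slice σ z w) σ)
      (-(lowerLeft γ σ / factor γ z σ) ^ 2) (z σ) := by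
  have hf := factor_ne_zero γ z σ
  convert! (hasDerivAt_const (z σ : ℂ) (lowerLeft γ σ)).div (hasDerivAt_factor γ σ z)
    (by simpa using hf) using 1
  rw [slice_self]
  ring

variable [NumberField K]

theorem isHolomorphic_of_mem {F : HPow K → ℂ} (hF : F ∈ QuasiModularRing K) :
    IsHolomorphic K F := by
  have : QuasiModularRing K ≤ Hol K := Algebra.adjoin_le fun F ⟨k, s, h⟩ => h.1
  exact this hF

open Classical in
/-- The derivative along `z_σ` of a quasi-modular form of weight `k` is quasi-modular, its
weight being larger by `2` in the coordinate `σ`. -/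
theorem IsQuasiModular.D {k : (K →+* ℝ) → ℤ} {s : ℕ} {F : HPow K → ℂ}
    (hF : IsQuasiModular K k s F) (σ : K →+* ℝ) :
    ∃ s', IsQuasiModular K (k + Pi.single σ 2) s' (D σ F) := by
  obtain ⟨hol, P, -, hP⟩ := hF
  refine ⟨_, hol.D σ, coeffDerivation _ (dHol σ) P +
    C (algebraMap ℂ (Hol K) (2 * π * Complex.I)⁻¹) *
      (C (algebraMap ℂ (Hol K) (k σ)) * X σ * P - X σ ^ 2 * pderiv σ P), rfl, fun z γ => ?_⟩
  have hf := factor_ne_zero γ z σ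
  have h1 := hol.hasDerivAt_act γ σ z
  have hx : ∀ τ, HasDerivAt (fun w => lowerLeft γ τ / factor γ (slice σ z w) τ)
      (if τ = σ then -(lowerLeft γ σ / factor γ z σ) ^ 2 else 0) (z σ) := by
    intro τ
    split_ifs with h
    · subst h
      exact hasDerivAt_lowerLeft_div_factor γ τ z
    · simp only [factor_slice_of_ne h]
      exact hasDerivAt_const _ _
  have h2 := (hasDerivAt_prod_factor_zpow γ k σ z).mul
    (hasDerivAt_eval₂ σ z (x := fun w τ => lowerLeft γ τ / factor γ (slice σ z w) τ) hx P)
  have h3 := h1.unique (h2.congr_of_eventuallyEq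
    (Filter.Eventually.of_forall fun w => hP (slice σ z w) γ))
  simp only [slice_self, ite_mul, zero_mul, Finset.sum_ite_eq', Finset.mem_univ, if_true] at h3
  have h4 : ∏ τ, factor γ z τ ^ (k + Pi.single σ 2 : (K →+* ℝ) → ℤ) τ =
      (∏ τ, factor γ z τ ^ k τ) * factor γ z σ ^ 2 := by
    simp only [Pi.add_apply, zpow_add₀ (factor_ne_zero γ z _), Finset.prod_mul_distrib]
    congr 1
    rw [Finset.prod_eq_single σ (fun τ _ h => by simp [h]) (by simp)]
    simp only [Pi.single_eq_same]
    norm_cast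
  rw [h4]
  simp only [eval₂_add, eval₂_sub, eval₂_mul, eval₂_C, eval₂_X, eval₂_pow, evalAt_algebraMap]
  have h5 := Complex.two_pi_I_ne_zero
  have h6 : HilbertQuasiModular.D σ F (act γ z) = (2 * π * Complex.I)⁻¹ *
      (2 * π * Complex.I * (HilbertQuasiModular.D σ F (act γ z) / factor γ z σ ^ 2)) *
        factor γ z σ ^ 2 := by
    field_simp
  rw [h6, h3]
  generalize (2 * π * Complex.I : ℂ) = a at h5 ⊢
  field_simp
  ring

theorem D_mem {F : HPow K → ℂ} (hF : F ∈ QuasiModularRing K) (σ : K →+* ℝ) :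
    D σ F ∈ QuasiModularRing K := by
  have hsub : QuasiModularRing K ≤ Hol K := fun F => isHolomorphic_of_mem
  induction hF using Algebra.adjoin_induction with
  | mem F h =>
    obtain ⟨k, s, h⟩ := h
    obtain ⟨s', h'⟩ := h.D σ
    exact Algebra.subset_adjoin ⟨_, s', h'⟩
  | algebraMap c =>
    have := congrArg Subtype.val ((dHol (K := K) σ).map_algebraMap c)
    erw [coe_dHol] at this
    erw [this]
    exact zero_mem _
  | add F G hF hG h1 h2 =>
    have := congrArg Subtype.val ((dHol σ).map_add ⟨F, hsub hF⟩ ⟨G, hsub hG⟩)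
    erw [coe_dHol] at this
    erw [this]
    exact add_mem h1 h2
  | mul F G hF hG h1 h2 =>
    have := congrArg Subtype.val ((dHol σ).leibniz ⟨F, hsub hF⟩ ⟨G, hsub hG⟩)
    erw [coe_dHol] at this
    erw [this]
    exact add_mem (mul_mem hF h2) (mul_mem hG h1)

end Derivatives

/-! ### Zariski density of the bottom rows -/

section Density

variable {K : Type*} [Field K]

theorem emb_injective [NumberField K] :
    Function.Injective (emb : (K →+* ℝ) → (𝓞 K →+* ℝ)) := fun _ _ h =>
  IsLocalization.ringHom_ext (nonZeroDivisors (𝓞 K)) h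

/-- The vectors `(σ(x))_σ`, for `x` in an integral basis, span `ℂⁿ`: a linear relation between
the coordinates would be a linear relation between distinct characters. -/
theorem exists_eq_sum_emb_basis [NumberField K] (v : (K →+* ℝ) → ℂ) :
    ∃ t : Module.Free.ChooseBasisIndex ℤ (𝓞 K) → ℂ,
      ∀ σ, v σ = ∑ j, ((emb σ (NumberField.RingOfIntegers.basis K j) : ℝ) : ℂ) * t j := by
  classical
  let b := NumberField.RingOfIntegers.basis K
  let L : (Module.Free.ChooseBasisIndex ℤ (𝓞 K) → ℂ) →ₗ[ℂ] ((K →+* ℝ) → ℂ) :=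
    Matrix.toLin' (Matrix.of fun σ j => ((emb σ (b j) : ℝ) : ℂ))
  suffices h : LinearMap.range L = ⊤ by
    obtain ⟨t, ht⟩ := LinearMap.range_eq_top.1 h v
    exact ⟨t, fun σ => by rw [← ht]; simp [L, Matrix.mulVec, dotProduct, b]⟩
  by_contra hne
  obtain ⟨f, hf, hle⟩ := Submodule.exists_le_ker_of_lt_top _ (lt_top_iff_ne_top.2 hne)
  let χ : (K →+* ℝ) → (𝓞 K →* ℂ) := fun σ => (Complex.ofRealHom.comp (emb σ) : 𝓞 K →+* ℂ)
  have hχ : Function.Injective χ := by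
    intro σ τ h
    apply emb_injective
    ext x
    exact Complex.ofReal_injective (DFunLike.congr_fun h x)
  have hlin := (linearIndependent_monoidHom (𝓞 K) ℂ).comp χ hχ
  have hfv : ∀ w, f w = ∑ σ, f (Pi.single σ 1) * w σ := by
    intro w
    conv_lhs => rw [← Finset.univ_sum_single w, map_sum]
    refine Finset.sum_congr rfl fun σ _ => ?_
    rw [mul_comm, ← smul_eq_mul, ← map_smul, ← Pi.single_smul, smul_eq_mul, mul_one]
  have hb : ∀ j, ∑ σ, f (Pi.single σ 1) * ((emb σ (b j) : ℝ) : ℂ) = 0 := by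
    intro j
    have : L (Pi.single j 1) ∈ LinearMap.ker f := hle ⟨_, rfl⟩
    rw [LinearMap.mem_ker, hfv] at this
    simpa [L] using this
  have hx : ∀ x : 𝓞 K, ∑ σ, f (Pi.single σ 1) * ((emb σ x : ℝ) : ℂ) = 0 := by
    intro x
    rw [← b.sum_repr x]
    simp only [map_sum, zsmul_eq_mul, map_mul, map_intCast, Complex.ofReal_sum,
      Complex.ofReal_mul, Finset.mul_sum]
    rw [Finset.sum_comm]
    refine Finset.sum_eq_zero fun j _ => ?_
    calc _ = (b.repr x j : ℂ) * ∑ σ, f (Pi.single σ 1) * ((emb σ (b j) : ℝ) : ℂ) := by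
          rw [Finset.mul_sum]
          refine Finset.sum_congr rfl fun σ _ => ?_
          push_cast
          ring
      _ = 0 := by rw [hb, mul_zero]
  have h0 := Fintype.linearIndependent_iff.1 hlin (fun σ => f (Pi.single σ 1)) (by
    ext x
    simpa [χ] using hx x)
  refine hf (LinearMap.ext fun w => ?_)
  rw [hfv]
  simp [h0]

/-- The image of `𝒪_K` in `ℂⁿ` is Zariski dense. -/
theorem eval_eq_zero_of_eval_emb [NumberField K] {p : MvPolynomial (K →+* ℝ) ℂ}
    (h : ∀ x : 𝓞 K, eval (fun σ => ((emb σ x : ℝ) : ℂ)) p = 0) (v : (K →+* ℝ) → ℂ) :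
    eval v p = 0 := by
  let b := NumberField.RingOfIntegers.basis K
  let q : MvPolynomial (Module.Free.ChooseBasisIndex ℤ (𝓞 K)) ℂ :=
    bind₁ (fun σ => ∑ j, C ((emb σ (b j) : ℝ) : ℂ) * X j) p
  have hq : ∀ t, eval t q = eval (fun σ => ∑ j, ((emb σ (b j) : ℝ) : ℂ) * t j) p := by
    intro t
    simp only [q, ← coe_aeval_eq_eval, RingHom.coe_coe, aeval_bind₁]
    simp
  have hq0 : q = 0 := by
    refine funext_set (fun _ => Set.range ((↑) : ℤ → ℂ))
      (fun _ => Set.infinite_range_of_injective Int.cast_injective) fun t ht => ?_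
    choose n hn using fun j => ht j trivial
    rw [hq, map_zero, ← h (∑ j, n j • b j)]
    congr 2
    ext σ
    simp [← hn, mul_comm]
  obtain ⟨t, ht⟩ := exists_eq_sum_emb_basis v
  have : eval t q = eval v p := by
    rw [hq]
    congr 2
    ext σ
    exact (ht σ).symm
  rw [← this, hq0, map_zero]

/-- The pairs `(a, ab + 1)` with `a, b ∈ 𝒪_K` are Zariski dense in `ℂ²ⁿ`. They are the bottom
rows of the products of a lower and an upper unipotent matrix. -/
theorem eq_zero_of_eval_unipotent_rows [NumberField K]
    {p : MvPolynomial ((K →+* ℝ) ⊕ (K →+* ℝ)) ℂ}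
    (h : ∀ a b : 𝓞 K, eval (Sum.elim (fun σ => ((emb σ a : ℝ) : ℂ))
      (fun σ => ((emb σ a : ℝ) : ℂ) * (emb σ b : ℝ) + 1)) p = 0) : p = 0 := by
  have h1 : ∀ (b : 𝓞 K) (v : (K →+* ℝ) → ℂ),
      eval (Sum.elim v (fun σ => v σ * (emb σ b : ℝ) + 1)) p = 0 := by
    intro b v
    have hq : ∀ v : (K →+* ℝ) → ℂ,
        eval v (bind₁ (Sum.elim X (fun σ => X σ * C ((emb σ b : ℝ) : ℂ) + 1)) p) =
          eval (Sum.elim v (fun σ => v σ * (emb σ b : ℝ) + 1)) p := by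
      intro v
      simp only [← coe_aeval_eq_eval, RingHom.coe_coe, aeval_bind₁]
      congr 2
      ext (i | i) <;> simp
    rw [← hq]
    exact eval_eq_zero_of_eval_emb (fun a => by rw [hq, h]) v
  have h2 : ∀ v w : (K →+* ℝ) → ℂ, eval (Sum.elim v (fun σ => v σ * w σ + 1)) p = 0 := by
    intro v w
    have hq : ∀ w : (K →+* ℝ) → ℂ,
        eval w (bind₁ (Sum.elim (fun σ => C (v σ)) (fun σ => C (v σ) * X σ + 1)) p) =
          eval (Sum.elim v (fun σ => v σ * w σ + 1)) p := by
      intro w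
      simp only [← coe_aeval_eq_eval, RingHom.coe_coe, aeval_bind₁]
      congr 2
      ext (i | i) <;> simp
    rw [← hq]
    exact eval_eq_zero_of_eval_emb (fun b => by rw [hq, h1]) w
  -- where no `x_σ` vanishes, every `(x, y)` is of the form `(v, vw + 1)`
  have h3 : p * ∏ σ, X (Sum.inl σ) = 0 := by
    refine funext fun x => ?_
    rw [map_zero, map_mul, map_prod, mul_eq_zero]
    by_cases hx : ∀ σ, x (Sum.inl σ) ≠ 0
    · left
      convert! h2 (fun σ => x (Sum.inl σ)) (fun σ => (x (Sum.inr σ) - 1) / x (Sum.inl σ)) using 2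
      congr 1
      ext (σ | σ)
      · rfl
      · simp [mul_div_cancel₀ _ (hx σ)]
    · right
      push Not at hx
      obtain ⟨σ, hσ⟩ := hx
      exact Finset.prod_eq_zero (Finset.mem_univ σ) (by simpa using hσ)
  exact (mul_eq_zero.1 h3).resolve_right (Finset.prod_ne_zero_iff.2 fun σ _ => X_ne_zero _)

end Density

/-! ### Polynomials in the bottom row with holomorphic coefficients -/

section Rows

variable {K : Type*} [Field K]

/-- The bottom row `(c, d)` of `γ`, embedded in `ℂ²ⁿ`. -/
def row (γ : Matrix.SpecialLinearGroup (Fin 2) (𝓞 K)) : (K →+* ℝ) ⊕ (K →+* ℝ) → ℂ :=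
  Sum.elim (lowerLeft γ) fun σ => (emb σ (γ 1 1) : ℝ)

/-- The unipotent matrix `(1 0; a 1)`. -/
def lowerUnipotent (a : 𝓞 K) : Matrix.SpecialLinearGroup (Fin 2) (𝓞 K) :=
  ⟨!![1, 0; a, 1], by simp⟩

/-- The unipotent matrix `(1 b; 0 1)`. -/
def upperUnipotent (b : 𝓞 K) : Matrix.SpecialLinearGroup (Fin 2) (𝓞 K) :=
  ⟨!![1, b; 0, 1], by simp⟩

theorem row_lowerUnipotent_mul_upperUnipotent (a b : 𝓞 K) :
    row (lowerUnipotent a * upperUnipotent b) = Sum.elim (fun σ => ((emb σ a : ℝ) : ℂ))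
      (fun σ => ((emb σ a : ℝ) : ℂ) * (emb σ b : ℝ) + 1) := by
  ext (σ | σ) <;>
  simp only [row, Sum.elim_inl, Sum.elim_inr, lowerLeft, Matrix.SpecialLinearGroup.coe_mul,
    Matrix.mul_apply, Fin.sum_univ_two] <;>
  simp [lowerUnipotent, upperUnipotent]

theorem row_lowerUnipotent (a : 𝓞 K) :
    row (lowerUnipotent a) = Sum.elim (fun σ => ((emb σ a : ℝ) : ℂ)) (fun _ => 1) := by
  ext (σ | σ) <;> simp [row, lowerLeft, lowerUnipotent]

theorem row_upperUnipotent (b : 𝓞 K) : row (upperUnipotent b) = row 1 := by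
  ext (σ | σ) <;> simp [row, lowerLeft, upperUnipotent]

theorem lowerUnipotent_add (a b : 𝓞 K) :
    lowerUnipotent (a + b) = lowerUnipotent a * lowerUnipotent b := by
  ext i j
  fin_cases i <;> fin_cases j <;>
  simp only [Matrix.SpecialLinearGroup.coe_mul, Matrix.mul_apply, Fin.sum_univ_two] <;>
  simp [lowerUnipotent]

theorem lowerUnipotent_zero : lowerUnipotent (0 : 𝓞 K) = 1 := by
  ext i j
  fin_cases i <;> fin_cases j <;> simp [lowerUnipotent]

variable [NumberField K]

theorem eq_zero_of_eval_row {p : MvPolynomial ((K →+* ℝ) ⊕ (K →+* ℝ)) ℂ}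
    (h : ∀ γ, eval (row γ) p = 0) : p = 0 :=
  eq_zero_of_eval_unipotent_rows fun a b => by
    rw [← row_lowerUnipotent_mul_upperUnipotent, h]

/-- Polynomials in `(c, d)` with holomorphic coefficients. -/
abbrev RowPoly (K : Type*) [Field K] [NumberField K] :=
  MvPolynomial ((K →+* ℝ) ⊕ (K →+* ℝ)) (Hol K)

/-- The value at `z` and at the bottom row of `γ` of a polynomial with holomorphic coefficients. -/
def rowEval (z : HPow K) (γ : Matrix.SpecialLinearGroup (Fin 2) (𝓞 K)) : RowPoly K →+* ℂ :=
  eval₂Hom (evalAt K z) (row γ)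

/-- A polynomial in `(c, d)` with holomorphic coefficients is determined by its values on
`ℋⁿ × SL₂(𝒪_K)`. -/
theorem RowPoly.ext_rowEval {p q : RowPoly K} (h : ∀ z γ, rowEval z γ p = rowEval z γ q) :
    p = q := by
  have h1 : ∀ z, map (evalAt K z) (p - q) = 0 := fun z =>
    eq_zero_of_eval_row fun γ => by
      rw [eval_map]
      change rowEval z γ (p - q) = 0
      rw [map_sub, h, sub_self]
  rw [← sub_eq_zero]
  ext1 m
  apply Hol.ext_evalAt
  intro z
  rw [← coeff_map, h1, coeff_zero, coeff_zero, map_zero]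

/-- The coordinate `z_σ`, as a holomorphic function. -/
def coord (σ : K →+* ℝ) : Hol K :=
  ⟨fun z => (z σ : ℂ), by
    refine DifferentiableOn.congr (f := fun w => w σ) (by fun_prop) fun w hw => ?_
    exact congrFun (toVec_ofComplex hw) σ⟩

/-- The automorphy factor `c_σ z_σ + d_σ`, as a polynomial in `(c, d)`. -/
def factorPoly (σ : K →+* ℝ) : RowPoly K := C (coord σ) * X (Sum.inl σ) + X (Sum.inr σ)

@[simp]
theorem rowEval_C (z : HPow K) (γ : Matrix.SpecialLinearGroup (Fin 2) (𝓞 K)) (F : Hol K) :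
    rowEval z γ (C F) = evalAt K z F := by
  simp [rowEval]

@[simp]
theorem rowEval_X_inl (z : HPow K) (γ : Matrix.SpecialLinearGroup (Fin 2) (𝓞 K)) (σ : K →+* ℝ) :
    rowEval z γ (X (Sum.inl σ)) = lowerLeft γ σ := by
  simp [rowEval, row]

@[simp]
theorem rowEval_factorPoly (z : HPow K) (γ : Matrix.SpecialLinearGroup (Fin 2) (𝓞 K))
    (σ : K →+* ℝ) : rowEval z γ (factorPoly σ) = factor γ z σ := by
  simp only [rowEval, row, factorPoly, map_add, map_mul, coe_eval₂Hom, eval₂_C, eval₂_X,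
    Sum.elim_inl, Sum.elim_inr, factor, mul_comm (evalAt K z _)]
  rfl

/-- The automorphism of the ring of polynomials in `(c, d)` that maps `d_σ` to `c_σ z_σ + d_σ`. -/
def shear : RowPoly K ≃ₐ[Hol K] RowPoly K :=
  AlgEquiv.ofAlgHom (aeval (Sum.elim (fun σ => X (Sum.inl σ)) factorPoly))
    (aeval (Sum.elim (fun σ => X (Sum.inl σ))
      fun σ => X (Sum.inr σ) - C (coord σ) * X (Sum.inl σ)))
    (by
      ext1 (σ | σ)
      · simp
      · simp [factorPoly, algHom_C, algebraMap_eq]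
        ring)
    (by
      ext1 (σ | σ)
      · simp
      · simp [factorPoly, algHom_C, algebraMap_eq]
        ring)

theorem prime_factorPoly (σ : K →+* ℝ) : Prime (factorPoly σ : RowPoly K) := by
  have h : factorPoly σ = shear (X (Sum.inr σ) : RowPoly K) := by simp [shear]
  rw [h, MulEquiv.prime_iff]
  exact X_prime

theorem totalDegree_factorPoly_pos (σ : K →+* ℝ) : 0 < (factorPoly σ : RowPoly K).totalDegree := by
  classical
  have h : coeff (Finsupp.single (Sum.inr σ) 1) (factorPoly σ : RowPoly K) ≠ 0 := by
    simp [factorPoly, coeff_C_mul, coeff_X, Finsupp.single_left_inj]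
  have := le_totalDegree (mem_support_iff.2 h)
  simp at this
  omega

theorem hasDerivAt_rowEval (σ : K →+* ℝ) (z : HPow K)
    (γ : Matrix.SpecialLinearGroup (Fin 2) (𝓞 K)) (p : RowPoly K) :
    HasDerivAt (fun w => rowEval (slice σ z w) γ p)
      (2 * π * Complex.I * rowEval z γ (coeffDerivation _ (dHol σ) p)) (z σ) := by
  simpa [rowEval] using
    hasDerivAt_eval₂ σ z (x := fun _ => row γ) (fun i => hasDerivAt_const _ _) p

end Rows

/-! ### The transformation formula of the elements of `𝒴(K)` -/

section Transformation

variable {K : Type*} [Field K] [NumberField K]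

variable (K) in
/-- The functions of `(z, γ)` that are polynomials in the bottom row `(c, d)` of `γ`, with
coefficients holomorphic in `z`, divided by a power of `∏_σ (c_σ z_σ + d_σ)`. -/
def rowFractions : Subalgebra ℂ (HPow K × Matrix.SpecialLinearGroup (Fin 2) (𝓞 K) → ℂ) where
  carrier := {Φ | ∃ (N : ℕ) (p : RowPoly K), ∀ z γ,
    (∏ σ, factor γ z σ) ^ N * Φ (z, γ) = rowEval z γ p}
  mul_mem' := by
    rintro Φ Ψ ⟨N, p, hp⟩ ⟨M, q, hq⟩
    refine ⟨N + M, p * q, fun z γ => ?_⟩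
    rw [map_mul, ← hp, ← hq, Pi.mul_apply]
    ring
  add_mem' := by
    rintro Φ Ψ ⟨N, p, hp⟩ ⟨M, q, hq⟩
    refine ⟨N + M, (∏ σ, factorPoly σ) ^ M * p + (∏ σ, factorPoly σ) ^ N * q, fun z γ => ?_⟩
    simp only [map_add, map_mul, map_pow, map_prod, rowEval_factorPoly, ← hp, ← hq, Pi.add_apply]
    ring
  algebraMap_mem' c := ⟨0, C (algebraMap ℂ (Hol K) c), fun z γ => by
    rw [rowEval_C, evalAt_algebraMap]
    simp⟩

theorem mem_rowFractions_of_hol (F : Hol K) :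
    (fun x : HPow K × Matrix.SpecialLinearGroup (Fin 2) (𝓞 K) => evalAt K x.1 F) ∈
      rowFractions K :=
  ⟨0, C F, fun z γ => by simp⟩

theorem lowerLeft_mem_rowFractions (σ : K →+* ℝ) :
    (fun x : HPow K × Matrix.SpecialLinearGroup (Fin 2) (𝓞 K) => lowerLeft x.2 σ) ∈
      rowFractions K :=
  ⟨0, X (Sum.inl σ), fun z γ => by simp⟩

theorem factor_mem_rowFractions (σ : K →+* ℝ) :
    (fun x : HPow K × Matrix.SpecialLinearGroup (Fin 2) (𝓞 K) => factor x.2 x.1 σ) ∈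
      rowFractions K :=
  ⟨0, factorPoly σ, fun z γ => by simp⟩

theorem factor_inv_mem_rowFractions (σ : K →+* ℝ) :
    (fun x : HPow K × Matrix.SpecialLinearGroup (Fin 2) (𝓞 K) => (factor x.2 x.1 σ)⁻¹) ∈
      rowFractions K := by
  classical
  refine ⟨1, ∏ τ ∈ Finset.univ.erase σ, factorPoly τ, fun z γ => ?_⟩
  simp only [map_prod, rowEval_factorPoly, pow_one]
  rw [← Finset.mul_prod_erase _ _ (Finset.mem_univ σ), mul_comm, ← mul_assoc,
    inv_mul_cancel₀ (factor_ne_zero γ z σ), one_mul]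

theorem factor_zpow_mem_rowFractions (σ : K →+* ℝ) (k : ℤ) :
    (fun x : HPow K × Matrix.SpecialLinearGroup (Fin 2) (𝓞 K) => factor x.2 x.1 σ ^ k) ∈
      rowFractions K := by
  obtain ⟨n, rfl | rfl⟩ := k.eq_nat_or_neg
  · simpa using! pow_mem (factor_mem_rowFractions σ) n
  · have := pow_mem (factor_inv_mem_rowFractions σ) n
    convert! this using 1
    ext x
    simp

theorem IsQuasiModular.mem_rowFractions {k : (K →+* ℝ) → ℤ} {s : ℕ} {F : HPow K → ℂ}
    (hF : IsQuasiModular K k s F) :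
    (fun x : HPow K × Matrix.SpecialLinearGroup (Fin 2) (𝓞 K) => F (act x.2 x.1)) ∈
      rowFractions K := by
  obtain ⟨-, P, -, hP⟩ := hF
  have h1 : (fun x : HPow K × Matrix.SpecialLinearGroup (Fin 2) (𝓞 K) => F (act x.2 x.1)) =
      (∏ σ, fun x => factor x.2 x.1 σ ^ k σ) *
        fun x => eval₂ (evalAt K x.1) (fun σ => lowerLeft x.2 σ / factor x.2 x.1 σ) P := by
    ext x
    rw [hP, Pi.mul_apply, Finset.prod_apply]
  rw [h1]
  clear h1 hP
  refine mul_mem (prod_mem fun σ _ => factor_zpow_mem_rowFractions σ _) ?_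
  induction P using MvPolynomial.induction_on with
  | C F => simpa using mem_rowFractions_of_hol F
  | add p q hp hq => simpa only [eval₂_add] using! add_mem hp hq
  | mul_X p σ hp =>
    simp only [eval₂_mul, eval₂_X, div_eq_mul_inv]
    simpa only [div_eq_mul_inv] using!
      mul_mem hp (mul_mem (lowerLeft_mem_rowFractions σ) (factor_inv_mem_rowFractions σ))

/-- The transformation formula satisfied by the elements of `𝒴(K)`. -/
theorem exists_rowPoly {F : HPow K → ℂ} (hF : F ∈ QuasiModularRing K) :
    ∃ (N : ℕ) (p : RowPoly K), ∀ z γ,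
      (∏ σ, factor γ z σ) ^ N * F (act γ z) = rowEval z γ p := by
  let L : (HPow K → ℂ) →ₐ[ℂ] (HPow K × Matrix.SpecialLinearGroup (Fin 2) (𝓞 K) → ℂ) :=
    { toFun F x := F (act x.2 x.1)
      map_one' := rfl
      map_mul' _ _ := rfl
      map_zero' := rfl
      map_add' _ _ := rfl
      commutes' _ := rfl }
  have : QuasiModularRing K ≤ (rowFractions K).comap L :=
    Algebra.adjoin_le fun F ⟨k, s, h⟩ => h.mem_rowFractions
  exact this hF

end Transformation

/-! ### Factorization of the polynomial in the transformation formula -/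

section Factorization

variable {K : Type*} [Field K] [NumberField K]

/-- The nonzero elements `w` of a domain that are coprime to `r` in the sense that `w` divides `q`
whenever it divides `q * r`. -/
def coprimeTo {A : Type*} [CommRing A] [IsDomain A] (r : A) : Submonoid A where
  carrier := {w | w ≠ 0 ∧ ∀ q, w ∣ q * r → w ∣ q}
  one_mem' := ⟨one_ne_zero, fun q _ => one_dvd q⟩
  mul_mem' := by
    rintro v w ⟨hv, hv'⟩ ⟨hw, hw'⟩
    refine ⟨mul_ne_zero hv hw, fun q hq => ?_⟩
    obtain ⟨q, rfl⟩ := hv' q ((dvd_mul_right v w).trans hq)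
    rw [mul_assoc] at hq
    exact mul_dvd_mul_left v (hw' q ((mul_dvd_mul_iff_left hv).1 hq))

theorem mem_coprimeTo_of_prime {A : Type*} [CommRing A] [IsDomain A] {r v : A} (hv : Prime v)
    (h : ¬ v ∣ r) : v ∈ coprimeTo r :=
  ⟨hv.ne_zero, fun _ hq => (hv.dvd_or_dvd hq).resolve_right h⟩

/-- All factors `c_σ z_σ + d_σ` can be split off a polynomial: each of them lowers the degree. -/
theorem exists_eq_prod_factorPoly_mul (p : RowPoly K) (hp : p ≠ 0) :
    ∃ (k : (K →+* ℝ) → ℕ) (r : RowPoly K),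
      p = (∏ σ, factorPoly σ ^ k σ) * r ∧ ∀ σ, ¬ factorPoly σ ∣ r := by
  classical
  induction h : p.totalDegree using Nat.strong_induction_on generalizing p with
  | _ n ih =>
    by_cases hdvd : ∃ σ, factorPoly σ ∣ p
    · obtain ⟨σ, q, rfl⟩ := hdvd
      have hq : q ≠ 0 := right_ne_zero_of_mul hp
      rw [totalDegree_mul_of_isDomain (left_ne_zero_of_mul hp) hq] at h
      have := totalDegree_factorPoly_pos σ
      obtain ⟨k, r, hk, hr⟩ := ih q.totalDegree (by omega) q hq rfl
      refine ⟨k + Pi.single σ 1, r, ?_, hr⟩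
      rw [hk, ← mul_assoc]
      congr 1
      simp only [Pi.add_apply, pow_add, Finset.prod_mul_distrib]
      rw [mul_comm]
      congr 1
      rw [Finset.prod_eq_single σ (fun τ _ h => by simp [h]) (by simp)]
      simp
    · push Not at hdvd
      exact ⟨0, p, by simp, hdvd⟩

/-- The constant polynomial `c ∈ ℂ`. -/
def scalarPoly (c : ℂ) : RowPoly K := C (algebraMap ℂ (Hol K) c)

theorem rowEval_scalarPoly (z : HPow K) (γ : Matrix.SpecialLinearGroup (Fin 2) (𝓞 K)) (c : ℂ) :
    rowEval z γ (scalarPoly c) = c := by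
  rw [scalarPoly, rowEval_C, evalAt_algebraMap]

/-- The relation `∂V_τ/∂z_σ = δ_{στ} c_σ`, for a product of powers of the factors
`V_τ = c_τ z_τ + d_τ`. -/
theorem coeffDerivation_prod_factorPoly (σ : K →+* ℝ) (k : (K →+* ℝ) → ℕ) :
    factorPoly σ * coeffDerivation _ (dHol σ) (∏ τ, factorPoly τ ^ k τ) =
      scalarPoly ((2 * π * Complex.I)⁻¹ * k σ) * X (Sum.inl σ) *
        ∏ τ, factorPoly τ ^ k τ := by
  refine RowPoly.ext_rowEval fun z γ => ?_
  have h1 := hasDerivAt_rowEval σ z γ (∏ τ, factorPoly τ ^ k τ)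
  simp only [map_prod, map_pow, rowEval_factorPoly] at h1
  have h2 := h1.unique (by simpa using hasDerivAt_prod_factor_zpow γ (fun τ => k τ) σ z)
  simp only [map_mul, map_prod, map_pow, rowEval_factorPoly, rowEval_X_inl, rowEval_scalarPoly]
  have hf := factor_ne_zero γ z σ
  have h5 := Complex.two_pi_I_ne_zero
  generalize (2 * π * Complex.I : ℂ) = a at h2 h5 ⊢
  rw [← inv_mul_cancel_left₀ h5 (rowEval z γ _), h2]
  field_simp

/-- The equation `D_σ F = G F`, differentiated along `γ`, as an identity of polynomials in `(c, d)`. -/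
theorem mul_coeffDerivation_eq {F G : HPow K → ℂ} {σ : K →+* ℝ} (hol : IsHolomorphic K F)
    (hFG : D σ F = G * F) {N M : ℕ} {p q : RowPoly K}
    (hp : ∀ z γ, (∏ σ, factor γ z σ) ^ N * F (act γ z) = rowEval z γ p)
    (hq : ∀ z γ, (∏ σ, factor γ z σ) ^ M * G (act γ z) = rowEval z γ q) :
    factorPoly σ ^ 2 * (∏ τ, factorPoly τ) ^ M * coeffDerivation _ (dHol σ) p =
      (scalarPoly ((2 * π * Complex.I)⁻¹ * N) * X (Sum.inl σ) * factorPoly σ *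
        (∏ τ, factorPoly τ) ^ M + q) * p := by
  refine RowPoly.ext_rowEval fun z γ => ?_
  have h1 := hasDerivAt_rowEval σ z γ p
  have h2 := (hasDerivAt_prod_factor_zpow γ (fun _ => N) σ z).mul (hol.hasDerivAt_act γ σ z)
  have h3 := h1.unique (h2.congr_of_eventuallyEq (Filter.Eventually.of_forall fun w => by
    simp [← hp, Finset.prod_pow]))
  simp only [zpow_natCast, Finset.prod_pow, slice_self, hFG, Pi.mul_apply] at h3
  simp only [map_mul, map_add, map_prod, map_pow, rowEval_factorPoly, rowEval_X_inl, rowEval_scalarPoly]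
  rw [← hp, ← hq]
  have hf := factor_ne_zero γ z σ
  have h5 := Complex.two_pi_I_ne_zero
  generalize (2 * π * Complex.I : ℂ) = a at h3 h5 ⊢
  rw [← inv_mul_cancel_left₀ h5 (rowEval z γ _), h3]
  field_simp
  push_cast
  ring

/-- If `p = w * r`, where `w` collects the factors coprime to `r`, divides its derivative
`w * r' + r * w'` up to such factors, and so does `w`, then `r` divides `r'`. -/
theorem dvd_of_mul_add_eq {A : Type*} [CommRing A] [IsDomain A] {U V a b r r' w w' : A}
    (hw : w ≠ 0) (hU : U ∈ coprimeTo r) (hV : V ∈ coprimeTo r)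
    (h1 : U * (w * r' + r * w') = a * (w * r)) (h2 : V * w' = b * w) : r ∣ r' := by
  have h3 : V * U * r' = (V * a - U * b) * r := by
    apply mul_left_cancel₀ hw
    linear_combination V * h1 - U * r * h2
  have hVU := mul_mem hV hU
  obtain ⟨c, hc⟩ := hVU.2 _ (Dvd.intro _ h3)
  refine ⟨c, mul_left_cancel₀ hVU.1 ?_⟩
  rw [h3, hc]
  ring

/-- If `F` divides `D_σ F` in `𝒴(K)`, the polynomial in `(c, d)` that describes `F(γ(z))` has, once
the factors `c_τ z_τ + d_τ` are split off, a logarithmic derivative with respect to `z_σ` that does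
not depend on `(c, d)`. -/
theorem exists_coeffDerivation_eq_C_mul {F : HPow K → ℂ} {σ : K →+* ℝ}
    (hF : IsHolomorphic K F) {G : HPow K → ℂ} (hG : G ∈ QuasiModularRing K) (hFG : D σ F = G * F)
    {N : ℕ} {k : (K →+* ℝ) → ℕ} {r : RowPoly K}
    (hp : ∀ z γ, (∏ σ, factor γ z σ) ^ N * F (act γ z) =
      rowEval z γ ((∏ σ, factorPoly σ ^ k σ) * r))
    (hr : ∀ σ, ¬ factorPoly σ ∣ r) :
    ∃ g : Hol K, coeffDerivation _ (dHol σ) r = C g * r := by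
  obtain ⟨M, q, hq⟩ := exists_rowPoly hG
  have h1 := mul_coeffDerivation_eq hF hFG hp hq
  have h2 := coeffDerivation_prod_factorPoly σ k
  rw [Derivation.leibniz, smul_eq_mul, smul_eq_mul] at h1
  have hw : (∏ σ, factorPoly σ ^ k σ : RowPoly K) ≠ 0 :=
    Finset.prod_ne_zero_iff.2 fun σ _ => pow_ne_zero _ (prime_factorPoly σ).ne_zero
  have hr0 : r ≠ 0 := fun h => hr σ (h ▸ dvd_zero _)
  have hmem : ∀ τ, factorPoly τ ∈ coprimeTo r := fun τ =>
    mem_coprimeTo_of_prime (prime_factorPoly τ) (hr τ)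
  obtain ⟨c, h4⟩ := dvd_of_mul_add_eq hw
    (mul_mem (pow_mem (hmem σ) 2) (pow_mem (prod_mem fun τ _ => hmem τ) M)) (hmem σ) h1 h2
  rw [mul_comm] at h4
  -- a derivation of the coefficients does not raise the degree in `(c, d)`
  have h5 : c.totalDegree = 0 := by
    by_cases hc0 : c = 0
    · rw [hc0, totalDegree_zero]
    · have := totalDegree_coeffDerivation_le (dHol σ) r
      rw [h4, totalDegree_mul_of_isDomain hc0 hr0] at this
      omega
  rw [h4, totalDegree_eq_zero_iff_eq_C.1 h5]
  exact ⟨_, rfl⟩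

/-- A polynomial with holomorphic coefficients whose logarithmic derivatives do not depend on
the variables is the product of a holomorphic function without zeros and of a polynomial with
complex coefficients. -/
theorem exists_eq_C_mul_map {κ : Type*} {r : MvPolynomial κ (Hol K)} (hr : r ≠ 0)
    {g : (K →+* ℝ) → Hol K} (h : ∀ σ, coeffDerivation _ (dHol σ) r = C (g σ) * r) :
    ∃ (f : Hol K) (ρ : MvPolynomial κ ℂ), (∀ z, evalAt K z f ≠ 0) ∧
      r = C f * map (algebraMap ℂ (Hol K)) ρ := by
  have hcoeff : ∀ σ m, dHol σ (coeff m r) = g σ * coeff m r := fun σ m => by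
    rw [← coeff_coeffDerivation, h, coeff_C_mul]
  -- any nonzero coefficient can serve as the function `f`
  obtain ⟨m₀, hm₀⟩ := ne_zero_iff.1 hr
  have hne : ∀ z, evalAt K z (coeff m₀ r) ≠ 0 := fun z hz =>
    hm₀ (eq_zero_of_dHol_eq_mul (fun σ => hcoeff σ m₀) hz)
  let z₀ : HPow K := fun _ => UpperHalfPlane.I
  refine ⟨coeff m₀ r, C (evalAt K z₀ (coeff m₀ r))⁻¹ * map (evalAt K z₀) r, hne, ?_⟩
  ext1 m
  rw [coeff_C_mul, coeff_map, coeff_C_mul, coeff_map, ← sub_eq_zero]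
  refine eq_zero_of_dHol_eq_mul (g := g) (z₀ := z₀) (fun σ => ?_) ?_
  · rw [map_sub, Derivation.leibniz, Derivation.map_algebraMap, hcoeff, hcoeff]
    simp only [smul_eq_mul]
    ring
  · rw [map_sub, map_mul, evalAt_algebraMap, mul_inv_cancel_left₀ (hne z₀), sub_self]

end Factorization

/-! ### Characters of the modular group that are polynomial in the bottom row -/

section Character

/-- A polynomial function on `ℂ` cannot satisfy `f(n + 1) = α f(n)` for all `n ∈ ℕ` unless `α = 1`,
as `f(x)` and `f(x + 1)` have the same leading coefficient. -/
theorem eq_one_of_eval_succ_eq_mul {f : Polynomial ℂ} (hf : f ≠ 0) {α : ℂ}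
    (h : ∀ n : ℕ, f.eval ((n : ℂ) + 1) = α * f.eval (n : ℂ)) : α = 1 := by
  have h1 : f.comp (Polynomial.X + Polynomial.C 1) = Polynomial.C α * f := by
    refine Polynomial.eq_of_infinite_eval_eq _ _ (Set.Infinite.mono ?_
      (Set.infinite_range_of_injective (Nat.cast_injective (R := ℂ))))
    rintro _ ⟨n, rfl⟩
    simp [h]
  have h2 := congrArg Polynomial.leadingCoeff h1
  rw [Polynomial.leadingCoeff_comp (by rw [Polynomial.natDegree_X_add_C]; exact one_ne_zero),
    Polynomial.leadingCoeff_X_add_C, one_pow, mul_one, Polynomial.leadingCoeff_mul,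
    Polynomial.leadingCoeff_C] at h2
  exact mul_right_cancel₀ (Polynomial.leadingCoeff_ne_zero.2 hf) (by rw [one_mul]; exact h2.symm)

variable {K : Type*} [Field K] [NumberField K]

/-- A character of `SL₂(𝒪_K)` that is given by a polynomial in the bottom row is trivial. On lower
unipotent matrices it is both exponential and polynomial, hence trivial; on upper unipotent
matrices it is trivial because their bottom row is that of the identity; and the products of such
matrices have a Zariski dense set of bottom rows. -/
theorem eval_row_eq_one {ρ : MvPolynomial ((K →+* ℝ) ⊕ (K →+* ℝ)) ℂ}
    (h1 : eval (row 1) ρ = 1)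
    (hmul : ∀ γ δ, eval (row (γ * δ)) ρ = eval (row γ) ρ * eval (row δ) ρ)
    (γ : Matrix.SpecialLinearGroup (Fin 2) (𝓞 K)) : eval (row γ) ρ = 1 := by
  have hlower : ∀ a : 𝓞 K, eval (row (lowerUnipotent a)) ρ = 1 := by
    intro a
    -- the restriction of `ρ` to the rows `(xa, 1)`, as a polynomial in `x`
    let f : Polynomial ℂ := aeval (Sum.elim
      (fun σ => Polynomial.C ((emb σ a : ℝ) : ℂ) * Polynomial.X) (fun _ => 1)) ρ
    have hf : ∀ n : ℕ, f.eval (n : ℂ) = eval (row (lowerUnipotent ((n : 𝓞 K) * a))) ρ := by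
      intro n
      rw [row_lowerUnipotent, ← Polynomial.coe_evalRingHom]
      simp only [f, aeval_def, hom_eval₂]
      change eval₂ _ _ ρ = eval₂ _ _ ρ
      congr 1
      · ext x
        simp
      · ext (σ | σ)
        · change _ = ((emb σ ((n : 𝓞 K) * a) : ℝ) : ℂ)
          rw [map_mul (emb σ), map_natCast, Complex.ofReal_mul,
            Complex.ofReal_natCast, mul_comm (n : ℂ)]
          simp
        · simp
    apply eq_one_of_eval_succ_eq_mul (f := f)
    · intro h0
      have := hf 0
      rw [h0] at this
      simp [lowerUnipotent_zero, h1] at this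
    · intro n
      have := hf (n + 1)
      rw [Nat.cast_succ] at this
      rw [this, hf, ← hmul, ← lowerUnipotent_add, Nat.cast_succ, add_mul, one_mul, add_comm]
  have h : ρ - 1 = 0 := eq_zero_of_eval_unipotent_rows fun a b => by
    rw [← row_lowerUnipotent_mul_upperUnipotent, map_sub, hmul, hlower, row_upperUnipotent, h1]
    simp
  rw [sub_eq_zero.1 h, map_one]

end Character

/-! ### Stable principal ideals -/

section Ideals

variable {K : Type*} [Field K] [NumberField K]

/-- An element of `𝒴(K)` that divides its derivatives in `𝒴(K)` is a modular form without
zeros. -/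
theorem exists_modular_of_D_eq_mul {F : HPow K → ℂ} (hF : F ∈ QuasiModularRing K) (hF0 : F ≠ 0)
    (hD : ∀ σ, ∃ G ∈ QuasiModularRing K, D σ F = G * F) :
    (∀ z, F z ≠ 0) ∧ ∃ k : (K →+* ℝ) → ℤ, ∀ z γ,
      F (act γ z) = (∏ σ, factor γ z σ ^ k σ) * F z := by
  have hol := isHolomorphic_of_mem hF
  choose G hG hFG using hD
  have hne : ∀ z, F z ≠ 0 := fun z hz => hF0 <| congrArg Subtype.val <|
    eq_zero_of_dHol_eq_mul (F := ⟨F, hol⟩) (g := fun σ => ⟨G σ, isHolomorphic_of_mem (hG σ)⟩)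
      (fun σ => Subtype.ext (hFG σ)) hz
  refine ⟨hne, ?_⟩
  have hprod : ∀ (γ : Matrix.SpecialLinearGroup (Fin 2) (𝓞 K)) (z : HPow K),
      ∏ σ, factor γ z σ ≠ 0 := fun γ z =>
    Finset.prod_ne_zero_iff.2 fun σ _ => factor_ne_zero γ z σ
  obtain ⟨N, p, hp⟩ := exists_rowPoly hF
  have hp0 : p ≠ 0 := by
    rintro rfl
    have := hp (fun _ => UpperHalfPlane.I) 1
    rw [map_zero] at this
    exact mul_ne_zero (pow_ne_zero _ (hprod _ _)) (hne _) this
  obtain ⟨k, r, rfl, hr⟩ := exists_eq_prod_factorPoly_mul p hp0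
  choose g hg using fun σ => exists_coeffDerivation_eq_C_mul hol (hG σ) (hFG σ) hp hr
  obtain ⟨f, ρ, hf, rfl⟩ := exists_eq_C_mul_map (right_ne_zero_of_mul hp0) hg
  have hρ : ∀ z γ, rowEval z γ (map (algebraMap ℂ (Hol K)) ρ) = eval (row γ) ρ := by
    intro z γ
    rw [rowEval, coe_eval₂Hom, eval₂_map]
    rfl
  -- the transformation formula before normalization of the polynomial `ρ`
  have h1 : ∀ z γ, F (act γ z) =
      (∏ σ, factor γ z σ ^ ((k σ : ℤ) - N)) * (evalAt K z f * eval (row γ) ρ) := by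
    intro z γ
    have h := hp z γ
    simp only [map_mul, map_prod, map_pow, rowEval_factorPoly, rowEval_C, hρ] at h
    apply mul_left_cancel₀ (pow_ne_zero N (hprod γ z))
    rw [h, ← mul_assoc ((∏ σ, factor γ z σ) ^ N)]
    congr 1
    rw [← Finset.prod_pow, ← Finset.prod_mul_distrib]
    refine Finset.prod_congr rfl fun σ _ => ?_
    rw [zpow_sub₀ (factor_ne_zero γ z σ), zpow_natCast, zpow_natCast,
      mul_div_cancel₀ _ (pow_ne_zero _ (factor_ne_zero γ z σ))]
  have h2 : ∀ z, F z = evalAt K z f * eval (row 1) ρ := fun z => by simpa using h1 z 1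
  have hρ1 : eval (row 1) ρ ≠ 0 := fun h =>
    hne (fun _ => UpperHalfPlane.I) (by rw [h2, h, mul_zero])
  -- `γ ↦ χ(c, d)` is multiplicative, as the automorphy factor is a cocycle and `F` has no zeros
  let χ : MvPolynomial ((K →+* ℝ) ⊕ (K →+* ℝ)) ℂ := C (eval (row 1) ρ)⁻¹ * ρ
  have h3 : ∀ z γ, F (act γ z) =
      (∏ σ, factor γ z σ ^ ((k σ : ℤ) - N)) * (F z * eval (row γ) χ) := by
    intro z γ
    rw [h1, h2]
    simp only [χ, map_mul, eval_C]
    field_simp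
  have hJ : ∀ (γ : Matrix.SpecialLinearGroup (Fin 2) (𝓞 K)) (z : HPow K),
      ∏ σ, factor γ z σ ^ ((k σ : ℤ) - N) ≠ 0 := fun γ z =>
    Finset.prod_ne_zero_iff.2 fun σ _ => zpow_ne_zero _ (factor_ne_zero γ z σ)
  have h4 : ∀ γ, eval (row γ) χ = 1 := by
    refine eval_row_eq_one ?_ fun γ δ => ?_
    · simp [χ, inv_mul_cancel₀ hρ1]
    · let z : HPow K := fun _ => UpperHalfPlane.I
      have h5 := h3 z (γ * δ)
      rw [act_mul, h3 (act δ z) γ, h3 z δ] at h5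
      simp only [factor_mul, mul_zpow, Finset.prod_mul_distrib] at h5
      apply mul_left_cancel₀ (mul_ne_zero (mul_ne_zero (hJ γ (act δ z)) (hJ δ z)) (hne z))
      linear_combination -h5
  exact ⟨fun σ => (k σ : ℤ) - N, fun z γ => by rw [h3, h4, mul_one]⟩

/-- The inverse of a modular form without zeros is a modular form, of the opposite weight. -/
theorem inv_mem_of_modular {F : HPow K → ℂ} (hol : IsHolomorphic K F) (hne : ∀ z, F z ≠ 0)
    {k : (K →+* ℝ) → ℤ}
    (hk : ∀ z γ, F (act γ z) = (∏ σ, factor γ z σ ^ k σ) * F z) :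
    F⁻¹ ∈ QuasiModularRing K := by
  have hinv : IsHolomorphic K F⁻¹ := DifferentiableOn.inv hol fun w _ => hne _
  refine Algebra.subset_adjoin ⟨-k, 0, hinv, C ⟨F⁻¹, hinv⟩, totalDegree_C _, fun z γ => ?_⟩
  rw [eval₂_C, evalAt_apply, Pi.inv_apply, hk, mul_inv, ← Finset.prod_inv_distrib]
  simp

theorem eq_top_of_isPrincipal_of_isDStable {I : Ideal (QuasiModularRing K)}
    (hI : Submodule.IsPrincipal I) (hI0 : I ≠ ⊥) (hD : IsDStable I) : I = ⊤ := by
  obtain ⟨F, rfl⟩ := hI.principal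
  have hF0 : (F : HPow K → ℂ) ≠ 0 := fun h => hI0 (by
    rw [show F = 0 from Subtype.ext h]
    exact Submodule.span_zero_singleton _)
  obtain ⟨hne, k, hk⟩ := exists_modular_of_D_eq_mul F.2 hF0 fun σ => by
    obtain ⟨H, hH, hHD⟩ := hD σ F (Submodule.mem_span_singleton_self F)
    obtain ⟨G, rfl⟩ := Submodule.mem_span_singleton.1 hH
    exact ⟨G, G.2, hHD.symm⟩
  refine Ideal.eq_top_of_isUnit_mem _ (Submodule.mem_span_singleton_self F) ?_
  refine IsUnit.of_mul_eq_one
    ⟨_, inv_mem_of_modular (isHolomorphic_of_mem F.2) hne hk⟩ (Subtype.ext ?_)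
  ext z
  exact mul_inv_cancel₀ (hne z)

end Ideals

end HilbertQuasiModular

end

theorem mainTheorem4 (K : Type*) [Field K] [NumberField K] [NumberField.IsTotallyReal K]
    (hn : 1 < Module.finrank ℚ K) :
    (∀ σ : K →+* ℝ, ∀ F ∈ HilbertQuasiModular.QuasiModularRing K,
      HilbertQuasiModular.D σ F ∈ HilbertQuasiModular.QuasiModularRing K) ∧
    ∀ I : Ideal (HilbertQuasiModular.QuasiModularRing K),
      Submodule.IsPrincipal I → I ≠ ⊥ → HilbertQuasiModular.IsDStable I → I = ⊤ :=
  ⟨fun σ _ hF => HilbertQuasiModular.D_mem hF σ,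
    fun _ hI hI0 hD => HilbertQuasiModular.eq_top_of_isPrincipal_of_isDStable hI hI0 hD⟩
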